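/- Let $N\ge 2$ and $1<p<\infty$. For $b^-<b^+$ let $$\Omega=\{x=(x',x_N)\in\mathbb{R}^{N-1}\times\mathbb{R} : b^-<x_N<b^+\},$$ and let $\dot W^{1,p}(\Omega)$ be the space of all real-valued $u\in L^1_{\mathrm{loc}}(\Omega)$ (modulo equality a.e.) whose weak first-order partial derivatives $\partial_1u,\dots,\partial_Nu$ belong to $L^p(\Omega)$. Let $\nu$ be the outward unit normal on $\partial\Omega=\{x_N=b^-\}\cup\{x_N=b^+\}$, and let $L^p_{\mathrm{loc}}(\partial\Omega)$ be the space of functions on $\partial\Omega$ (modulo equality $\mathcal{H}^{N-1}$-a.e.) that belong to $L^p(K)$ with respect to $\mathcal{H}^{N-1}$ for every compact $K\subseteq\partial\Omega$. For $a>0$ and $f\in L^1_{\mathrm{loc}}(\mathbb{R}^{N-1})$ put $$|f|_{\widetilde W^{1-1/p,p}_{(a)}(\mathbb{R}^{N-1})}=\left(\int_{\mathbb{R}^{N-1}}\int_{\{|h'|<a\}}\frac{|f(x'+h')-f(x')|^p}{|h'|^{p+N-2}}\,dh'\,dx'\right)^{1/p}\in[0,\infty].$$ There is a constant $c=c(N,p)>0$,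 depending only on $N$ and $p$, such that for all $b^-<b^+$ there exists a linear operator $$\operatorname{Tr}:\dot W^{1,p}(\Omega)\to L^p_{\mathrm{loc}}(\partial\Omega)$$ satisfying the following. 1. $\operatorname{Tr}(u)=u$ on $\partial\Omega$ for all $u\in\dot W^{1,p}(\Omega)\cap C^0(\overline\Omega)$. 2. For all $u\in\dot W^{1,p}(\Omega)$, $$\int_{\mathbb{R}^{N-1}}|\operatorname{Tr}(u)(x',b^+)-\operatorname{Tr}(u)(x',b^-)|^p\,dx'\le (b^+-b^-)^{p-1}\int_\Omega|\partial_Nu(x)|^p\,dx$$ and, for each of the two signs, $$|\operatorname{Tr}(u)(\cdot,b^\pm)|^p_{\widetilde W^{1-1/p,p}_{(b^+-b^-)}(\mathbb{R}^{N-1})}\le c\int_\Omega|\nabla u(x)|^p\,dx.$$ 3. For all $u\in\dot W^{1,p}(\Omega)$, all $\psi\in C^1_c(\mathbb{R}^N)$ and all $i=1,\dots,N$, $$\int_\Omega u\,\partial_i\psi\,dx=-\int_\Omega\psi\,\partial_iu\,dx+\int_{\partial\Omega}\psi\operatorname{Tr}(u)\,\nu_i\,d\mathcal{H}^{N-1},$$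 where all three integrals converge absolutely. Moreover, this operator is unique: any linear operator $\dot W^{1,p}(\Omega)\to L^p_{\mathrm{loc}}(\partial\Omega)$ that satisfies 1, 2 (with some constant $c'>0$ in place of $c$) and 3 equals $\operatorname{Tr}$. -/

import Mathlib

open MeasureTheory Set
open scoped ENNReal ContDiff

namespace HomogeneousTrace

noncomputable section

/-- Euclidean space `ℝⁿ` with its Euclidean norm and Lebesgue measure. -/
abbrev RSpace (n : ℕ) := EuclideanSpace ℝ (Fin n)

/-- The classical partial derivative `∂ᵢ φ`. -/
def classicalPartial {n : ℕ} (i : Fin n) (φ : RSpace n → ℝ) (x : RSpace n) : ℝ :=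
  fderiv ℝ φ x (EuclideanSpace.single i 1)

/-- `f` is locally in `L^q` on `S` with respect to `μ`: it is in `L^q(K)` for all compact `K ⊆ S`. -/
def IsLocLp {n : ℕ} (q : ℝ≥0∞) (μ : Measure (RSpace n)) (S : Set (RSpace n))
    (f : RSpace n → ℝ) : Prop :=
  ∀ K : Set (RSpace n), IsCompact K → K ⊆ S → MemLp f q (μ.restrict K)

/-- `g ∈ L¹_loc(U)` is the `i`-th weak (distributional) partial derivative of `u` on `U`. -/
def IsWeakPartial {n : ℕ} (U : Set (RSpace n)) (i : Fin n) (u g : RSpace n → ℝ) : Prop :=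
  IsLocLp 1 volume U g ∧
  ∀ φ : RSpace n → ℝ, ContDiff ℝ ∞ φ → HasCompactSupport φ → tsupport φ ⊆ U →
    ∫ x in U, u x * classicalPartial i φ x = -∫ x in U, g x * φ x

section Helpers

variable {n : ℕ} {q : ℝ≥0∞} {μ : Measure (RSpace n)} {S : Set (RSpace n)}

theorem IsLocLp.add {f g : RSpace n → ℝ} (hf : IsLocLp q μ S f) (hg : IsLocLp q μ S g) :
    IsLocLp q μ S (f + g) := fun K hK hKS => (hf K hK hKS).add (hg K hK hKS)

theorem IsLocLp.smul {f : RSpace n → ℝ} (c : ℝ) (hf : IsLocLp q μ S f) :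
    IsLocLp q μ S (c • f) := fun K hK hKS => (hf K hK hKS).const_smul c

theorem IsLocLp.zero : IsLocLp q μ S 0 := fun _ _ _ => MemLp.zero

theorem IsLocLp.congr {f g : RSpace n → ℝ} (hf : IsLocLp q μ S f)
    (h : f =ᵐ[μ.restrict S] g) : IsLocLp q μ S g := fun K hK hKS =>
  (hf K hK hKS).ae_eq (ae_mono (Measure.restrict_mono hKS le_rfl) h)

theorem IsLocLp.integrableOn_mul {f φ : RSpace n → ℝ} (hf : IsLocLp 1 volume S f)
    (hφ : Continuous φ) (hc : HasCompactSupport φ) (hS : tsupport φ ⊆ S) :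
    IntegrableOn (fun x => f x * φ x) S := by
  have h1 : IntegrableOn f (tsupport φ) := memLp_one_iff_integrable.1 (hf _ hc hS)
  have h2 : IntegrableOn (fun x => f x * φ x) (tsupport φ) :=
    h1.mul_continuousOn hφ.continuousOn hc
  refine IntegrableOn.mono_set ?_ (subset_univ S)
  refine h2.of_forall_sdiff_eq_zero MeasurableSet.univ ?_
  intro x hx
  simp [image_eq_zero_of_notMem_tsupport hx.2]

theorem continuous_classicalPartial {φ : RSpace n → ℝ} (hφ : ContDiff ℝ ∞ φ) (i : Fin n) :
    Continuous (classicalPartial i φ) :=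
  (hφ.continuous_fderiv (by simp)).clm_apply continuous_const

theorem tsupport_classicalPartial (φ : RSpace n → ℝ) (i : Fin n) :
    tsupport (classicalPartial i φ) ⊆ tsupport φ :=
  tsupport_fderiv_apply_subset ℝ _

theorem hasCompactSupport_classicalPartial {φ : RSpace n → ℝ} (hc : HasCompactSupport φ)
    (i : Fin n) : HasCompactSupport (classicalPartial i φ) :=
  hc.mono' ((subset_tsupport _).trans (tsupport_classicalPartial φ i))

theorem IsWeakPartial.add {i : Fin n} {u v g h : RSpace n → ℝ}
    (hu : IsLocLp 1 volume S u) (hv : IsLocLp 1 volume S v)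
    (hg : IsWeakPartial S i u g) (hh : IsWeakPartial S i v h) :
    IsWeakPartial S i (u + v) (g + h) := by
  refine ⟨hg.1.add hh.1, fun φ h1 h2 h3 => ?_⟩
  have c1 := continuous_classicalPartial h1 i
  have c2 := hasCompactSupport_classicalPartial h2 i
  have c3 := (tsupport_classicalPartial φ i).trans h3
  simp only [Pi.add_apply, add_mul]
  rw [integral_add (hu.integrableOn_mul c1 c2 c3) (hv.integrableOn_mul c1 c2 c3),
    integral_add (hg.1.integrableOn_mul h1.continuous h2 h3)
      (hh.1.integrableOn_mul h1.continuous h2 h3), hg.2 φ h1 h2 h3, hh.2 φ h1 h2 h3]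
  ring

theorem IsWeakPartial.smul {i : Fin n} {u g : RSpace n → ℝ} (c : ℝ)
    (hg : IsWeakPartial S i u g) : IsWeakPartial S i (c • u) (c • g) := by
  refine ⟨hg.1.smul c, fun φ h1 h2 h3 => ?_⟩
  simp only [Pi.smul_apply, smul_eq_mul, mul_assoc]
  rw [integral_const_mul, integral_const_mul, hg.2 φ h1 h2 h3]
  ring

theorem IsWeakPartial.zero (i : Fin n) : IsWeakPartial S i 0 0 :=
  ⟨IsLocLp.zero, fun φ _ _ _ => by simp⟩

theorem IsWeakPartial.congr {i : Fin n} {u v g : RSpace n → ℝ} (hg : IsWeakPartial S i u g)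
    (h : u =ᵐ[volume.restrict S] v) : IsWeakPartial S i v g := by
  refine ⟨hg.1, fun φ h1 h2 h3 => ?_⟩
  rw [← hg.2 φ h1 h2 h3]
  refine integral_congr_ae ?_
  filter_upwards [h] with x hx
  rw [hx]

end Helpers

/-- The homogeneous Sobolev space `Ẇ^{1,p}(U)`: all (a.e. classes of) `u ∈ L¹_loc(U)` whose weak
first order partial derivatives on `U` belong to `L^p(U)`. -/
def HomSobolev {n : ℕ} (p : ℝ) (U : Set (RSpace n)) :
    Submodule ℝ (RSpace n →ₘ[volume.restrict U] ℝ) where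
  carrier := {u | IsLocLp 1 volume U u ∧
    ∀ i : Fin n, ∃ g : RSpace n → ℝ,
      MemLp g (ENNReal.ofReal p) (volume.restrict U) ∧ IsWeakPartial U i u g}
  add_mem' := by
    rintro u v ⟨hu, hu'⟩ ⟨hv, hv'⟩
    have e := (AEEqFun.coeFn_add u v).symm
    refine ⟨(hu.add hv).congr e, fun i => ?_⟩
    obtain ⟨g, hg, hg'⟩ := hu' i
    obtain ⟨h, hh, hh'⟩ := hv' i
    exact ⟨g + h, hg.add hh, (IsWeakPartial.add hu hv hg' hh').congr e⟩
  zero_mem' := by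
    have e := (AEEqFun.coeFn_zero (α := RSpace n) (β := ℝ) (μ := volume.restrict U)).symm
    exact ⟨IsLocLp.zero.congr e, fun i => ⟨0, MemLp.zero, (IsWeakPartial.zero i).congr e⟩⟩
  smul_mem' := by
    rintro c u ⟨hu, hu'⟩
    have e := (AEEqFun.coeFn_smul c u).symm
    refine ⟨(hu.smul c).congr e, fun i => ?_⟩
    obtain ⟨g, hg, hg'⟩ := hu' i
    exact ⟨c • g, hg.const_smul c, (hg'.smul c).congr e⟩

/-- The weak partial derivative `∂ᵢ u ∈ L^p(U)` of `u ∈ Ẇ^{1,p}(U)` (unique a.e. in `U`). -/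
def weakPartial {n : ℕ} {p : ℝ} {U : Set (RSpace n)} (u : HomSobolev p U) (i : Fin n) :
    RSpace n → ℝ :=
  (u.2.2 i).choose

theorem weakPartial_spec {n : ℕ} {p : ℝ} {U : Set (RSpace n)} (u : HomSobolev p U) (i : Fin n) :
    MemLp (weakPartial u i) (ENNReal.ofReal p) (volume.restrict U) ∧
      IsWeakPartial U i u.1 (weakPartial u i) :=
  (u.2.2 i).choose_spec

/-- The weak gradient `∇u`. -/
def weakGradient {n : ℕ} {p : ℝ} {U : Set (RSpace n)} (u : HomSobolev p U) (x : RSpace n) :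
    RSpace n :=
  WithLp.toLp 2 fun i => weakPartial u i x

/-- The strip `{x ∈ ℝ^{d+1} | b⁻ < x_{d+1} < b⁺}`. -/
def strip (d : ℕ) (bm bp : ℝ) : Set (RSpace (d + 1)) :=
  {x | bm < x (Fin.last d) ∧ x (Fin.last d) < bp}

/-- The point `(x', t) ∈ ℝ^d × ℝ = ℝ^{d+1}`. -/
def consLast {d : ℕ} (x' : RSpace d) (t : ℝ) : RSpace (d + 1) :=
  WithLp.toLp 2 (Fin.snoc (α := fun _ => ℝ) (fun i => x' i) t)

/-- The surface measure on `∂Ω`: the `d`-dimensional Hausdorff measure (normalized to agree with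
Lebesgue measure on `d`-dimensional planes) restricted to the boundary of the strip. -/
def bdryMeasure (d : ℕ) (bm bp : ℝ) : Measure (RSpace (d + 1)) :=
  (μHE[d] : Measure (RSpace (d + 1))).restrict (frontier (strip d bm bp))

/-- The outward unit normal `ν` on the boundary of the strip. -/
def outwardNormal (d : ℕ) (bm bp : ℝ) (x : RSpace (d + 1)) : RSpace (d + 1) :=
  if x (Fin.last d) = bp then EuclideanSpace.single (Fin.last d) 1
  else if x (Fin.last d) = bm then -EuclideanSpace.single (Fin.last d) 1
  else 0

/-- The space `L^p_loc(∂Ω)` of (a.e. classes of) functions on the boundary of the strip. -/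
def LpLocBdry (d : ℕ) (p bm bp : ℝ) :
    Submodule ℝ (RSpace (d + 1) →ₘ[bdryMeasure d bm bp] ℝ) where
  carrier := {f | IsLocLp (ENNReal.ofReal p) μHE[d] (frontier (strip d bm bp)) f}
  add_mem' := fun {u v} hu hv => (hu.add hv).congr (AEEqFun.coeFn_add u v).symm
  zero_mem' := IsLocLp.zero.congr
    (AEEqFun.coeFn_zero (α := RSpace (d + 1)) (β := ℝ) (μ := bdryMeasure d bm bp)).symm
  smul_mem' := fun c u hu => (hu.smul c).congr (AEEqFun.coeFn_smul c u).symm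

/-- The screened homogeneous fractional seminorm `|f|_{W̃^{s,p}_{(a)}(ℝ^d)}` with constant screening
function `a`, as an extended nonnegative real. -/
def screenedSeminorm {d : ℕ} (s p a : ℝ) (f : RSpace d → ℝ) : ℝ≥0∞ :=
  (∫⁻ x : RSpace d, ∫⁻ h in Metric.ball (0 : RSpace d) a,
    ‖f (x + h) - f x‖ₑ ^ p / ‖h‖ₑ ^ (s * p + d)) ^ (1 / p)

/-- The properties characterizing the trace on the strip, with `c` the constant in the bound on the
screened seminorm. -/
structure IsStripTrace {d : ℕ} {p bm bp : ℝ} (c : ℝ)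
    (Tr : HomSobolev p (strip d bm bp) →ₗ[ℝ] LpLocBdry d p bm bp) : Prop where
  /-- `Tr u = u` on `∂Ω` if `u` is (has a representative) continuous on the closure of `Ω`. -/
  eq_of_continuous : ∀ (u : HomSobolev p (strip d bm bp)) (w : RSpace (d + 1) → ℝ),
    ContinuousOn w (closure (strip d bm bp)) →
    (u : RSpace (d + 1) →ₘ[volume.restrict (strip d bm bp)] ℝ)
      =ᵐ[volume.restrict (strip d bm bp)] w →
    (Tr u : RSpace (d + 1) →ₘ[bdryMeasure d bm bp] ℝ) =ᵐ[bdryMeasure d bm bp] w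
  /-- The bound on the difference of the traces on the two boundary planes. -/
  difference_bound : ∀ u : HomSobolev p (strip d bm bp),
    ∫⁻ x' : RSpace d, ‖(Tr u).1 (consLast x' bp) - (Tr u).1 (consLast x' bm)‖ₑ ^ p ≤
      ENNReal.ofReal ((bp - bm) ^ (p - 1)) *
        ∫⁻ x in strip d bm bp, ‖weakPartial u (Fin.last d) x‖ₑ ^ p
  /-- The bound on the screened seminorm of the traces on the two boundary planes. -/
  screened_bound : ∀ u : HomSobolev p (strip d bm bp), ∀ b : ℝ, b = bm ∨ b = bp →
    (screenedSeminorm (1 - 1 / p) p (bp - bm) fun x' : RSpace d => (Tr u).1 (consLast x' b)) ^ p ≤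
      ENNReal.ofReal c * ∫⁻ x in strip d bm bp, ‖weakGradient u x‖ₑ ^ p
  /-- The integration by parts formula, in which all integrals converge absolutely. -/
  integration_by_parts : ∀ (u : HomSobolev p (strip d bm bp)) (ψ : RSpace (d + 1) → ℝ),
    ContDiff ℝ 1 ψ → HasCompactSupport ψ → ∀ i : Fin (d + 1),
    IntegrableOn (fun x => u.1 x * classicalPartial i ψ x) (strip d bm bp) ∧
    IntegrableOn (fun x => ψ x * weakPartial u i x) (strip d bm bp) ∧
    Integrable (fun x => ψ x * (Tr u).1 x * outwardNormal d bm bp x i) (bdryMeasure d bm bp) ∧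
    ∫ x in strip d bm bp, u.1 x * classicalPartial i ψ x =
      -(∫ x in strip d bm bp, ψ x * weakPartial u i x) +
        ∫ x, ψ x * (Tr u).1 x * outwardNormal d bm bp x i ∂(bdryMeasure d bm bp)

end

end HomogeneousTrace

/-! The trace is read off along vertical lines. For almost every $x'$ the restriction $u(x',\cdot)$
agrees a.e. with $t \mapsto f^-(x') + \int_{b^-}^t \partial_N u(x',s)\,ds$. The interval is bounded
and $\partial_N u(x',\cdot)$ is integrable up to both ends, so there are end values $f^-$ and $f^+$,
and these are the trace (`exists_vertical_primitive`, `IsSobolevPair.exists_tracePair`). No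
approximation of $u$ by smooth functions is needed. `ae_sub_eq_integral_of_weak` expresses
$u(x+h)-u(x)$ as an integral of the directional derivative over the segment, for almost every $x$,
by testing the weak derivative against translates; it is used for vertical and for horizontal $h$.

The bound on $f^+-f^-$ is Hölder's inequality on vertical segments. For the screened seminorm, $x'$
and $x'+h'$ are joined by going up to height $r$, across, and down again, with $r$ averaged over
$(|h'|/2,|h'|)$. In polar coordinates in $h'$ the vertical legs become the left side of Hardy's
inequality (`hardy_Ioo`). The horizontal leg becomes an average with kernel $1/r$ over $(r/2,r)$,
which is bounded with constant one (`lintegral_Ioo_inv_mul_lintegral_le`). The screening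
$|h'|<b^+-b^-$ keeps every such path inside the strip, so the constant does not depend on $b^\pm$
(`exists_screened_slab_bound`). Finiteness of the seminorm also upgrades local integrability of the
end values to local $L^p$ (`memLp_of_screened`).

Vertical integration by parts is the one-dimensional formula on each line; horizontal integration by
parts follows by differentiating an integral against translates of $\psi$. Since $\nu_N=\pm1$ on the
two planes, the formula for $i=N$ alone determines the trace (`bdry_eq_of_integral_eq`). This gives
uniqueness, and also linearity of the pointwise construction. -/

namespace HomogeneousTrace

/-! ### One-dimensional integral inequalities -/

section


/-- Integration in polar coordinates for nonnegative radial functions. -/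
theorem exists_lintegral_comp_norm {d : ℕ} (hd : 1 ≤ d) : ∃ K : ℝ≥0∞, K ≠ ⊤ ∧
    ∀ F : ℝ → ℝ≥0∞, Measurable F →
      ∫⁻ h : RSpace d, F ‖h‖ = K * ∫⁻ r in Ioi (0 : ℝ), ENNReal.ofReal (r ^ (d - 1)) * F r := by
  have : Nontrivial (RSpace d) := by
    have : Nonempty (Fin d) := ⟨⟨0, hd⟩⟩
    infer_instance
  let μ : Measure (RSpace d) := volume
  refine ⟨μ.toSphere univ, measure_ne_top _ _, fun F hF => ?_⟩
  have hdim : Module.finrank ℝ (RSpace d) = d := by simp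
  calc ∫⁻ h : RSpace d, F ‖h‖
      = ∫⁻ x : ({(0)}ᶜ : Set (RSpace d)), F ‖x.1‖ ∂(μ.comap (↑)) := by
        rw [lintegral_subtype_comap (measurableSet_singleton _).compl fun x ↦ F ‖x‖,
          restrict_compl_singleton]
    _ = ∫⁻ x, F x.2 ∂μ.toSphere.prod (.volumeIoiPow (Module.finrank ℝ (RSpace d) - 1)) := by
        have := μ.measurePreserving_homeomorphUnitSphereProd.lintegral_comp_emb
          (Homeomorph.measurableEmbedding _) (F ∘ Subtype.val ∘ Prod.snd)
        simpa using this
    _ = μ.toSphere univ * ∫⁻ x : Ioi (0 : ℝ), F x ∂.volumeIoiPow (Module.finrank ℝ (RSpace d) - 1) := by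
        rw [lintegral_prod _ (by fun_prop)]
        simp [mul_comm]
    _ = _ := by
        rw [hdim, Measure.volumeIoiPow, lintegral_withDensity_eq_lintegral_mul _ (by fun_prop)
          (by fun_prop)]
        congr 1
        exact lintegral_subtype_comap measurableSet_Ioi
          (fun x : ℝ => ENNReal.ofReal (x ^ (d - 1)) * F x)

/-- Tonelli's theorem for a kernel, with a pointwise bound on the column integrals. -/
theorem lintegral_kernel_le {α β : Type*} [MeasurableSpace α] [MeasurableSpace β]
    {μ : Measure α} {ν : Measure β} [SFinite μ] [SFinite ν] {k : α → β → ℝ≥0∞}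
    (hk : Measurable (Function.uncurry k)) {φ C : β → ℝ≥0∞} (hφ : Measurable φ)
    (hC : ∀ᵐ s ∂ν, ∫⁻ r, k r s ∂μ ≤ C s) :
    ∫⁻ r, ∫⁻ s, k r s * φ s ∂ν ∂μ ≤ ∫⁻ s, C s * φ s ∂ν := by
  rw [lintegral_lintegral_swap]
  · refine lintegral_mono_ae (hC.mono fun s hs => ?_)
    rw [lintegral_mul_const _ (by exact hk.comp measurable_prodMk_right)]
    gcongr
  · exact (hk.mul (hφ.comp measurable_snd)).aemeasurable

theorem lintegral_Ioo_rpow_neg_half {r : ℝ} (hr : 0 ≤ r) :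
    ∫⁻ s in Ioo 0 r, ENNReal.ofReal (s ^ (-(1 / 2) : ℝ)) = ENNReal.ofReal (2 * r ^ (1 / 2 : ℝ)) := by
  have h1 : IntervalIntegrable (fun s : ℝ => s ^ (-(1 / 2) : ℝ)) volume 0 r :=
    intervalIntegral.intervalIntegrable_rpow' (by norm_num)
  rw [intervalIntegrable_iff_integrableOn_Ioo_of_le hr] at h1
  rw [← ofReal_integral_eq_lintegral_ofReal h1]
  · rw [← integral_Ioc_eq_integral_Ioo, ← intervalIntegral.integral_of_le hr,
      integral_rpow (Or.inl (by norm_num)), show (-(1 / 2) + 1 : ℝ) = 1 / 2 by norm_num,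
      Real.zero_rpow (by norm_num)]
    congr 1
    ring
  · filter_upwards [ae_restrict_mem measurableSet_Ioo] with s hs
    exact Real.rpow_nonneg hs.1.le _

theorem lintegral_Ioi_rpow {q s : ℝ} (hq : q < -1) (hs : 0 < s) :
    ∫⁻ r in Ioi s, ENNReal.ofReal (r ^ q) = ENNReal.ofReal (-s ^ (q + 1) / (q + 1)) := by
  rw [← integral_Ioi_rpow_of_lt hq hs,
    ofReal_integral_eq_lintegral_ofReal (integrableOn_Ioi_rpow_of_lt hq hs)]
  filter_upwards [ae_restrict_mem measurableSet_Ioi] with r hr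
  exact Real.rpow_nonneg (hs.trans hr).le _

/-- Hölder's inequality for the splitting $g = (s^{\alpha} g)\, s^{-\alpha}$ with $\alpha =
(p-1)/(2p)$. The conjugate power of the second factor is $s^{-1/2}$, which is integrable at zero.
The weight left on $g^p$ is what makes the Schur-type argument for Hardy's inequality close. -/
theorem rpow_lintegral_Ioo_le {p : ℝ} (hp : 1 < p) {g : ℝ → ℝ≥0∞} (hg : Measurable g) {r : ℝ}
    (hr : 0 < r) :
    (∫⁻ s in Ioo 0 r, g s) ^ p ≤ ENNReal.ofReal (2 ^ (p - 1) * r ^ ((p - 1) / 2)) *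
      ∫⁻ s in Ioo 0 r, ENNReal.ofReal (s ^ ((p - 1) / 2)) * g s ^ p := by
  have hp0 : 0 < p := by linarith
  have hpq : p.HolderConjugate (p / (p - 1)) := Real.HolderConjugate.conjExponent hp
  have key := ENNReal.lintegral_mul_le_Lp_mul_Lq (volume.restrict (Ioo 0 r)) hpq
    (f := fun s => ENNReal.ofReal (s ^ ((p - 1) / (2 * p))) * g s)
    (g := fun s => ENNReal.ofReal (s ^ (-((p - 1) / (2 * p))))) (by fun_prop) (by fun_prop)
  have e0 : ∫⁻ s in Ioo 0 r, ((fun s => ENNReal.ofReal (s ^ ((p - 1) / (2 * p))) * g s) *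
      fun s => ENNReal.ofReal (s ^ (-((p - 1) / (2 * p))))) s = ∫⁻ s in Ioo 0 r, g s := by
    refine setLIntegral_congr_fun measurableSet_Ioo fun s hs => ?_
    have : ENNReal.ofReal (s ^ ((p - 1) / (2 * p))) * ENNReal.ofReal (s ^ (-((p - 1) / (2 * p))))
        = 1 := by
      rw [← ENNReal.ofReal_mul (Real.rpow_nonneg hs.1.le _), ← Real.rpow_add hs.1]
      simp
    simp only [Pi.mul_apply]
    rw [mul_right_comm, this, one_mul]
  have e1 : ∫⁻ s in Ioo 0 r, (ENNReal.ofReal (s ^ ((p - 1) / (2 * p))) * g s) ^ p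
      = ∫⁻ s in Ioo 0 r, ENNReal.ofReal (s ^ ((p - 1) / 2)) * g s ^ p := by
    refine setLIntegral_congr_fun measurableSet_Ioo fun s hs => ?_
    rw [ENNReal.mul_rpow_of_nonneg _ _ hp0.le, ENNReal.ofReal_rpow_of_nonneg
      (Real.rpow_nonneg hs.1.le _) hp0.le, ← Real.rpow_mul hs.1.le]
    congr 3
    field_simp
  have e2 : ∫⁻ s in Ioo 0 r, ENNReal.ofReal (s ^ (-((p - 1) / (2 * p)))) ^ (p / (p - 1))
      = ENNReal.ofReal (2 * r ^ (1 / 2 : ℝ)) := by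
    rw [← lintegral_Ioo_rpow_neg_half hr.le]
    refine setLIntegral_congr_fun measurableSet_Ioo fun s hs => ?_
    have : 0 < p - 1 := by linarith
    rw [ENNReal.ofReal_rpow_of_nonneg (Real.rpow_nonneg hs.1.le _) (by positivity),
      ← Real.rpow_mul hs.1.le]
    congr 2
    field_simp
  rw [e0, e1, e2] at key
  calc (∫⁻ s in Ioo 0 r, g s) ^ p ≤ _ := ENNReal.rpow_le_rpow key hp0.le
    _ = _ := by
      rw [ENNReal.mul_rpow_of_nonneg _ _ hp0.le, ← ENNReal.rpow_mul, ← ENNReal.rpow_mul, mul_comm]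
      congr 1
      · rw [ENNReal.ofReal_rpow_of_nonneg (by positivity)
          (by have : 0 < p - 1 := by linarith
              positivity)]
        have e : 1 / (p / (p - 1)) * p = p - 1 := by field_simp
        rw [e, Real.mul_rpow (by norm_num) (by positivity), ← Real.rpow_mul hr.le]
        congr 3
        ring
      · rw [one_div, inv_mul_cancel₀ hp0.ne', ENNReal.rpow_one]

/-- **Hardy's inequality** on a bounded interval. -/
theorem hardy_Ioo {p : ℝ} (hp : 1 < p) {g : ℝ → ℝ≥0∞} (hg : Measurable g) (a : ℝ) :
    ∫⁻ r in Ioo 0 a, ENNReal.ofReal (r ^ (-p)) * (∫⁻ s in Ioo 0 r, g s) ^ p ≤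
      ENNReal.ofReal (2 ^ p / (p - 1)) * ∫⁻ s in Ioo 0 a, g s ^ p := by
  have hp1 : 0 < p - 1 := by linarith
  -- The exponent is $-p + (p-1)/2 = -(p+1)/2$: the Hardy weight times the power of $r$ from the
  -- weighted Hölder bound.
  set k : ℝ → ℝ → ℝ≥0∞ := fun r s =>
    ({z : ℝ × ℝ | z.2 < z.1}.indicator
      (fun z => ENNReal.ofReal (2 ^ (p - 1) * z.1 ^ (-(p + 1) / 2))) (r, s)) *
        ENNReal.ofReal (s ^ ((p - 1) / 2)) with hk_def
  have hk : Measurable (Function.uncurry k) := by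
    refine Measurable.mul ?_ (by fun_prop)
    refine Measurable.indicator (by fun_prop) (measurableSet_lt measurable_snd measurable_fst)
  calc _ ≤ ∫⁻ r in Ioo 0 a, ∫⁻ s in Ioo 0 a, k r s * g s ^ p := by
        refine setLIntegral_mono' measurableSet_Ioo fun r hr => ?_
        calc _ ≤ _ := mul_le_mul_right (rpow_lintegral_Ioo_le hp hg hr.1) _
          _ = ENNReal.ofReal (2 ^ (p - 1) * r ^ (-(p + 1) / 2)) *
                ∫⁻ s in Ioo 0 r, ENNReal.ofReal (s ^ ((p - 1) / 2)) * g s ^ p := by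
              rw [← mul_assoc, ← ENNReal.ofReal_mul (Real.rpow_nonneg hr.1.le _)]
              congr 2
              rw [mul_left_comm, ← Real.rpow_add hr.1]
              congr 2
              ring
          _ = ∫⁻ s in Ioo 0 r, k r s * g s ^ p := by
              rw [← lintegral_const_mul _ (by fun_prop)]
              refine setLIntegral_congr_fun measurableSet_Ioo fun s hs => ?_
              simp [hk_def, hs.2, mul_assoc]
          _ ≤ _ := lintegral_mono_set (Ioo_subset_Ioo_right hr.2.le)
    _ ≤ ∫⁻ s in Ioo 0 a, ENNReal.ofReal (2 ^ p / (p - 1)) * g s ^ p := by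
        refine lintegral_kernel_le hk (by fun_prop) ?_
        filter_upwards [ae_restrict_mem measurableSet_Ioo] with s hs
        simp only [hk_def]
        have hm : Measurable fun r : ℝ => ENNReal.ofReal (2 ^ (p - 1) * r ^ (-(p + 1) / 2)) := by
          fun_prop
        have : ∀ r : ℝ, ({z : ℝ × ℝ | z.2 < z.1}.indicator
            (fun z => ENNReal.ofReal (2 ^ (p - 1) * z.1 ^ (-(p + 1) / 2))) (r, s)) =
            (Ioi s).indicator (fun r => ENNReal.ofReal (2 ^ (p - 1) * r ^ (-(p + 1) / 2))) r :=
          fun r => rfl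
        simp_rw [this]
        rw [lintegral_mul_const _ (hm.indicator measurableSet_Ioi)]
        -- Extending the column integral to $(s,\infty)$ gives a multiple $2/(p-1)$ of
        -- $s^{-(p-1)/2}$, which cancels the weight $s^{(p-1)/2}$ exactly and leaves $2^{p-1}\cdot
        -- 2/(p-1)$.
        have h2 : ∫⁻ r in Ioo 0 a, (Ioi s).indicator
            (fun r => ENNReal.ofReal (2 ^ (p - 1) * r ^ (-(p + 1) / 2))) r ≤
            ENNReal.ofReal (2 ^ (p - 1)) * ENNReal.ofReal (-s ^ (-(p + 1) / 2 + 1) /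
              (-(p + 1) / 2 + 1)) := by
          rw [← lintegral_Ioi_rpow (by linarith) hs.1, ← lintegral_const_mul _ (by fun_prop)]
          refine (lintegral_mono' Measure.restrict_le_self le_rfl).trans ?_
          rw [lintegral_indicator measurableSet_Ioi]
          refine lintegral_mono fun r => ?_
          rw [ENNReal.ofReal_mul (by positivity)]
        refine (mul_le_mul_left h2 _).trans_eq ?_
        rw [← ENNReal.ofReal_mul (by positivity), ← ENNReal.ofReal_mul]
        · congr 1
          have e1 : -(p + 1) / 2 + 1 = -((p - 1) / 2) := by ring
          have e2 : (2 : ℝ) ^ p = 2 ^ (p - 1) * 2 := by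
            rw [← Real.rpow_add_one (by norm_num)]; ring_nf
          have e3 : s ^ (-((p - 1) / 2)) * s ^ ((p - 1) / 2) = 1 := by
            rw [← Real.rpow_add hs.1]; simp
          rw [e1, e2, neg_div_neg_eq, div_div_eq_mul_div]
          calc _ = 2 ^ (p - 1) * 2 / (p - 1) * (s ^ (-((p - 1) / 2)) * s ^ ((p - 1) / 2)) := by ring
            _ = _ := by rw [e3, mul_one]
        · have e1 : -(p + 1) / 2 + 1 = -((p - 1) / 2) := by ring
          rw [e1, neg_div_neg_eq]
          have := hs.1
          positivity
    _ = _ := lintegral_const_mul _ (by fun_prop)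

/-- A point $s$ lies in $(r/2,r)$ only for $r\in(s,2s)$, an interval of length $s$ on which $1/r\le
1/s$; so $s$ is counted with total weight at most one. With $(0,r)$ in place of $(r/2,r)$ the weight
would be $\log(a/s)$, which is why heights are later averaged away from zero. -/
theorem lintegral_Ioo_inv_mul_lintegral_le {φ : ℝ → ℝ≥0∞} (hφ : Measurable φ) (a : ℝ) :
    ∫⁻ r in Ioo 0 a, ENNReal.ofReal r⁻¹ * ∫⁻ s in Ioo (r / 2) r, φ s ≤ ∫⁻ s in Ioo 0 a, φ s := by
  set k : ℝ → ℝ → ℝ≥0∞ := fun r s =>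
    ({z : ℝ × ℝ | z.1 / 2 < z.2 ∧ z.2 < z.1}.indicator (fun z => ENNReal.ofReal z.1⁻¹) (r, s))
    with hk_def
  have hk : Measurable (Function.uncurry k) :=
    Measurable.indicator (by fun_prop) ((measurableSet_lt (by fun_prop) measurable_snd).inter
      (measurableSet_lt measurable_snd measurable_fst))
  calc _ ≤ ∫⁻ r in Ioo 0 a, ∫⁻ s in Ioo 0 a, k r s * φ s := by
        refine setLIntegral_mono' measurableSet_Ioo fun r hr => ?_
        calc _ = ∫⁻ s in Ioo (r / 2) r, k r s * φ s := by
              rw [← lintegral_const_mul _ hφ]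
              refine setLIntegral_congr_fun measurableSet_Ioo fun s hs => ?_
              simp [hk_def, hs.1, hs.2]
          _ ≤ _ := lintegral_mono_set
            (Ioo_subset_Ioo (by linarith [hr.1]) hr.2.le)
    _ ≤ ∫⁻ s in Ioo 0 a, 1 * φ s := by
        refine lintegral_kernel_le hk hφ ?_
        filter_upwards [ae_restrict_mem measurableSet_Ioo] with s hs
        calc ∫⁻ r in Ioo 0 a, k r s ≤ ∫⁻ r, k r s := lintegral_mono' Measure.restrict_le_self le_rfl
          _ ≤ ∫⁻ r, (Ioo s (2 * s)).indicator (fun _ => ENNReal.ofReal s⁻¹) r := by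
              refine lintegral_mono fun r => ?_
              simp only [hk_def, indicator_apply, mem_ofPred_eq, mem_Ioo]
              split_ifs with h1 h2
              · exact ENNReal.ofReal_le_ofReal (inv_anti₀ hs.1 h1.2.le)
              · exact absurd ⟨h1.2, by linarith [h1.1]⟩ h2
              · exact zero_le
              · exact le_rfl
          _ = 1 := by
              rw [lintegral_indicator measurableSet_Ioo, setLIntegral_const, Real.volume_Ioo,
                ← ENNReal.ofReal_mul (by have := hs.1; positivity)]
              have := hs.1.ne'
              rw [show s⁻¹ * (2 * s - s) = 1 by field_simp; ring, ENNReal.ofReal_one]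
    _ = _ := by simp

end

/-! ### The screened seminorm estimate on a half slab -/

section


theorem measurable_lintegral_Ioo {α : Type*} [MeasurableSpace α] {G : α → ℝ → ℝ≥0∞}
    (hG : Measurable (Function.uncurry G)) {l : ℝ → ℝ} (hl : Measurable l) :
    Measurable fun z : α × ℝ => ∫⁻ s in Ioo (l z.2) z.2, G z.1 s := by
  have h1 : MeasurableSet {y : (α × ℝ) × ℝ | l y.1.2 < y.2 ∧ y.2 < y.1.2} :=
    (measurableSet_lt (f := fun y : (α × ℝ) × ℝ => l y.1.2) (by fun_prop) measurable_snd).inter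
      (measurableSet_lt measurable_snd (g := fun y : (α × ℝ) × ℝ => y.1.2) (by fun_prop))
  have h2 : Measurable fun y : (α × ℝ) × ℝ => G y.1.1 y.2 :=
    hG.comp (by fun_prop : Measurable fun y : (α × ℝ) × ℝ => (y.1.1, y.2))
  have h3 := (h2.indicator h1).lintegral_prod_right' (ν := (volume : Measure ℝ))
  convert h3 using 2 with z
  rw [← lintegral_indicator measurableSet_Ioo]
  rfl

theorem add_add_rpow_le {p : ℝ} (hp : 1 ≤ p) (x y z : ℝ≥0∞) :
    (x + y + z) ^ p ≤ 2 ^ (p - 1) * 2 ^ (p - 1) * (x ^ p + y ^ p + z ^ p) := by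
  have h1 : (1 : ℝ≥0∞) ≤ 2 ^ (p - 1) := by
    simpa using ENNReal.rpow_le_rpow_of_exponent_le (x := 2) (by norm_num)
      (show (0 : ℝ) ≤ p - 1 by linarith)
  calc (x + y + z) ^ p ≤ 2 ^ (p - 1) * ((x + y) ^ p + z ^ p) :=
        ENNReal.rpow_add_le_mul_rpow_add_rpow _ _ hp
    _ ≤ 2 ^ (p - 1) * (2 ^ (p - 1) * (x ^ p + y ^ p) + 2 ^ (p - 1) * z ^ p) := by
        gcongr
        · exact ENNReal.rpow_add_le_mul_rpow_add_rpow _ _ hp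
        · exact le_mul_of_one_le_left zero_le h1
    _ = _ := by ring

variable {d : ℕ}

/-- The `L^p` bound on a translation difference of `f` in terms of a function `w` on a half slab
attaining `f` at height zero. -/
theorem lintegral_translate_sub_le {p : ℝ} (hp : 1 < p) {a : ℝ} {f : RSpace d → ℝ}
    {w : RSpace d → ℝ → ℝ} {G : RSpace d → ℝ → ℝ≥0∞}
    (hw : Measurable (Function.uncurry w)) (hG : Measurable (Function.uncurry G))
    (hvert : ∀ᵐ r ∂volume.restrict (Ioo 0 a), ∀ᵐ x : RSpace d,
      ‖w x r - f x‖ₑ ≤ ∫⁻ s in Ioo 0 r, G x s) (h : RSpace d) (hh : 0 < ‖h‖) (hha : ‖h‖ < a)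
    (hhor : ∫⁻ r in Ioo (‖h‖ / 2) ‖h‖, ∫⁻ x, ‖w (x + h) r - w x r‖ₑ ^ p ≤
      ‖h‖ₑ ^ p * ∫⁻ r in Ioo (‖h‖ / 2) ‖h‖, ∫⁻ x, G x r ^ p) :
    ∫⁻ x, ‖f (x + h) - f x‖ₑ ^ p ≤ 2 ^ (p - 1) * 2 ^ (p - 1) *
      (2 * (∫⁻ x, (∫⁻ s in Ioo 0 ‖h‖, G x s) ^ p) +
        2 * ENNReal.ofReal (‖h‖ ^ (p - 1)) * ∫⁻ r in Ioo (‖h‖ / 2) ‖h‖, ∫⁻ x, G x r ^ p) := by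
  have hp0 : 0 < p := by linarith
  set ρ := ‖h‖ with hρ
  set D := ∫⁻ x, ‖f (x + h) - f x‖ₑ ^ p
  set V := ∫⁻ x, (∫⁻ s in Ioo 0 ρ, G x s) ^ p
  set Γ := ∫⁻ r in Ioo (ρ / 2) ρ, ∫⁻ x, G x r ^ p
  set K : ℝ≥0∞ := 2 ^ (p - 1) * 2 ^ (p - 1)
  have hVm : Measurable fun x => (∫⁻ s in Ioo 0 ρ, G x s) ^ p := by
    have h1 : Measurable fun x => ∫⁻ s in Ioo 0 ρ, G x s := hG.lintegral_prod_right'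
    exact h1.pow_const p
  have hslice : ∀ r, Measurable fun x => w x r := fun r => hw.comp measurable_prodMk_right
  have hDm : ∀ r, Measurable fun x => ‖w (x + h) r - w x r‖ₑ ^ p := fun r =>
    ((((hslice r).comp (measurable_add_const h)).sub (hslice r)).enorm).pow_const p
  -- The path through height $r$: down to $f$ at $x+h$, across at height $r$, down to $f$ at $x$.
  -- Both vertical legs are enlarged to height $\rho$, and by translation invariance they contribute
  -- the same $V$.
  have hae : ∀ᵐ r ∂volume.restrict (Ioo (ρ / 2) ρ),
      D ≤ K * (V + (∫⁻ x, ‖w (x + h) r - w x r‖ₑ ^ p) + V) := by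
    have hsub : Ioo (ρ / 2) ρ ⊆ Ioo 0 a := Ioo_subset_Ioo (by positivity) hha.le
    filter_upwards [ae_mono (Measure.restrict_mono hsub le_rfl) hvert,
      ae_restrict_mem measurableSet_Ioo] with r hr hrm
    have hr' : ∀ᵐ x : RSpace d, ‖w (x + h) r - f (x + h)‖ₑ ≤ ∫⁻ s in Ioo 0 r, G (x + h) s :=
      (quasiMeasurePreserving_add_right (volume : Measure (RSpace d)) h).ae hr
    have hmono : ∀ x, ∫⁻ s in Ioo 0 r, G x s ≤ ∫⁻ s in Ioo 0 ρ, G x s := fun x =>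
      lintegral_mono_set (Ioo_subset_Ioo_right hrm.2.le)
    calc D ≤ ∫⁻ x, K * ((∫⁻ s in Ioo 0 ρ, G (x + h) s) ^ p + ‖w (x + h) r - w x r‖ₑ ^ p +
          (∫⁻ s in Ioo 0 ρ, G x s) ^ p) := by
          refine lintegral_mono_ae ?_
          filter_upwards [hr, hr'] with x h1 h2
          refine le_trans (ENNReal.rpow_le_rpow ?_ hp0.le) (add_add_rpow_le hp.le _ _ _)
          have e : f (x + h) - f x = -(w (x + h) r - f (x + h)) + (w (x + h) r - w x r) +
            (w x r - f x) := by ring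
          rw [e]
          refine (enorm_add_le _ _).trans (add_le_add ((enorm_add_le _ _).trans
            (add_le_add ?_ le_rfl)) (h1.trans (hmono x)))
          rw [enorm_neg]
          exact h2.trans (hmono _)
      _ = K * ((∫⁻ x, (∫⁻ s in Ioo 0 ρ, G (x + h) s) ^ p) +
            (∫⁻ x, ‖w (x + h) r - w x r‖ₑ ^ p) + V) := by
          have hVm' : Measurable fun x => (∫⁻ s in Ioo 0 ρ, G (x + h) s) ^ p :=
            hVm.comp (measurable_add_const h)
          have hVD : Measurable fun x => (∫⁻ s in Ioo 0 ρ, G (x + h) s) ^ p +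
            ‖w (x + h) r - w x r‖ₑ ^ p := hVm'.add (hDm r)
          have hVDV : Measurable fun x => (∫⁻ s in Ioo 0 ρ, G (x + h) s) ^ p +
            ‖w (x + h) r - w x r‖ₑ ^ p + (∫⁻ s in Ioo 0 ρ, G x s) ^ p := hVD.add hVm
          rw [lintegral_const_mul _ hVDV, lintegral_add_left hVD, lintegral_add_left hVm']
      _ = _ := by
          rw [lintegral_add_right_eq_self (fun x => (∫⁻ s in Ioo 0 ρ, G x s) ^ p) h]
  have hBm : Measurable fun r => ∫⁻ x, ‖w (x + h) r - w x r‖ₑ ^ p := by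
    refine Measurable.lintegral_prod_left' (f := fun z : RSpace d × ℝ =>
      ‖w (z.1 + h) z.2 - w z.1 z.2‖ₑ ^ p) ?_
    refine (Measurable.enorm (Measurable.sub ?_ hw)).pow_const p
    exact hw.comp (by fun_prop : Measurable fun z : RSpace d × ℝ => (z.1 + h, z.2))
  -- $D$ does not depend on $r$, so integrating over $(\rho/2,\rho)$ multiplies it by $\rho/2$.
  -- Dividing back turns the factor $\rho^p$ of the horizontal leg into $2\rho^{p-1}$.
  have hint : ENNReal.ofReal (ρ / 2) * D ≤
      K * (2 * V * ENNReal.ofReal (ρ / 2) + ENNReal.ofReal (ρ ^ p) * Γ) := by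
    calc ENNReal.ofReal (ρ / 2) * D = ∫⁻ _ in Ioo (ρ / 2) ρ, D := by
          rw [setLIntegral_const, Real.volume_Ioo, mul_comm]
          congr 2
          ring
      _ ≤ ∫⁻ r in Ioo (ρ / 2) ρ, K * (V + (∫⁻ x, ‖w (x + h) r - w x r‖ₑ ^ p) + V) :=
          lintegral_mono_ae hae
      _ = K * (V * ENNReal.ofReal (ρ / 2) +
            (∫⁻ r in Ioo (ρ / 2) ρ, ∫⁻ x, ‖w (x + h) r - w x r‖ₑ ^ p) +
              V * ENNReal.ofReal (ρ / 2)) := by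
          rw [lintegral_const_mul _ (by fun_prop), lintegral_add_right _ measurable_const,
            lintegral_add_right _ hBm, setLIntegral_const, Real.volume_Ioo, sub_half]
      _ ≤ K * (V * ENNReal.ofReal (ρ / 2) + ENNReal.ofReal (ρ ^ p) * Γ +
            V * ENNReal.ofReal (ρ / 2)) := by
          gcongr
          rw [← ENNReal.ofReal_rpow_of_nonneg hh.le hp0.le, hρ, ofReal_norm]
          exact hhor
      _ = _ := by ring
  have e1 : ENNReal.ofReal (2 / ρ) * ENNReal.ofReal (ρ / 2) = 1 := by
    rw [← ENNReal.ofReal_mul (by positivity), ← ENNReal.ofReal_one]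
    congr 1
    field_simp
  have e2 : ENNReal.ofReal (2 / ρ) * ENNReal.ofReal (ρ ^ p) =
      2 * ENNReal.ofReal (ρ ^ (p - 1)) := by
    rw [← ENNReal.ofReal_mul (by positivity), Real.rpow_sub_one hh.ne',
      show (2 : ℝ≥0∞) = ENNReal.ofReal 2 by simp, ← ENNReal.ofReal_mul (by positivity)]
    congr 1
    field_simp
  calc D = ENNReal.ofReal (2 / ρ) * (ENNReal.ofReal (ρ / 2) * D) := by
        rw [← mul_assoc, e1, one_mul]
    _ ≤ ENNReal.ofReal (2 / ρ) * (K * (2 * V * ENNReal.ofReal (ρ / 2) +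
          ENNReal.ofReal (ρ ^ p) * Γ)) := by gcongr
    _ = K * (2 * V * (ENNReal.ofReal (2 / ρ) * ENNReal.ofReal (ρ / 2)) +
          ENNReal.ofReal (2 / ρ) * ENNReal.ofReal (ρ ^ p) * Γ) := by ring
    _ = _ := by rw [e1, e2, mul_one]

/-- The trace inequality for the screened seminorm on a half slab. -/
theorem exists_screened_slab_bound (hd : 1 ≤ d) {p : ℝ} (hp : 1 < p) : ∃ C : ℝ≥0∞, C ≠ ⊤ ∧
    ∀ (a : ℝ) (f : RSpace d → ℝ) (w : RSpace d → ℝ → ℝ) (G : RSpace d → ℝ → ℝ≥0∞),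
      Measurable f → Measurable (Function.uncurry w) → Measurable (Function.uncurry G) →
      (∀ᵐ r ∂volume.restrict (Ioo 0 a), ∀ᵐ x : RSpace d,
        ‖w x r - f x‖ₑ ≤ ∫⁻ s in Ioo 0 r, G x s) →
      (∀ (h : RSpace d) (r₁ r₂ : ℝ), 0 ≤ r₁ → r₂ ≤ a →
        ∫⁻ r in Ioo r₁ r₂, ∫⁻ x, ‖w (x + h) r - w x r‖ₑ ^ p ≤
          ‖h‖ₑ ^ p * ∫⁻ r in Ioo r₁ r₂, ∫⁻ x, G x r ^ p) →
      ∫⁻ x : RSpace d, ∫⁻ h in Metric.ball (0 : RSpace d) a,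
        ‖f (x + h) - f x‖ₑ ^ p / ‖h‖ₑ ^ ((1 - 1 / p) * p + d) ≤
          C * ∫⁻ r in Ioo 0 a, ∫⁻ x, G x r ^ p := by
  have hp0 : 0 < p := by linarith
  obtain ⟨K₀, hK₀, hpolar⟩ := exists_lintegral_comp_norm hd
  set K : ℝ≥0∞ := 2 ^ (p - 1) * 2 ^ (p - 1) with hK
  have hKtop : K ≠ ⊤ := by
    have h2 : (2 : ℝ≥0∞) ^ (p - 1) ≠ ⊤ :=
      ENNReal.rpow_ne_top_of_nonneg (by linarith) (by norm_num)
    exact ENNReal.mul_ne_top h2 h2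
  refine ⟨K₀ * (K * (2 * ENNReal.ofReal (2 ^ p / (p - 1)) + 2)), ?_, ?_⟩
  · refine ENNReal.mul_ne_top hK₀ (ENNReal.mul_ne_top hKtop ?_)
    finiteness
  intro a f w G hf hw hG hvert hhor
  set q : ℝ := (1 - 1 / p) * p + d with hq
  have hq' : q = p - 1 + d := by rw [hq]; field_simp
  set V : ℝ → ℝ≥0∞ := fun r => ∫⁻ x, (∫⁻ s in Ioo 0 r, G x s) ^ p with hV
  set Γ : ℝ → ℝ≥0∞ := fun r => ∫⁻ x, G x r ^ p with hΓ
  have hVm : Measurable V := by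
    have h1 := (measurable_lintegral_Ioo hG (measurable_const (a := (0 : ℝ)))).pow_const p
    exact h1.lintegral_prod_left
  have hΓm : Measurable Γ := (hG.pow_const p).lintegral_prod_left
  have hΓi : Measurable fun r : ℝ => ∫⁻ s in Ioo (r / 2) r, Γ s :=
    (measurable_lintegral_Ioo (α := Unit) (G := fun _ => Γ) (by exact hΓm.comp measurable_snd)
      (l := fun r => r / 2) (by fun_prop)).comp (measurable_prodMk_left (x := ()))
  -- A radial majorant in $h$, cut off at radius $a$ so that the integral over the ball extends to
  -- the whole space, where polar coordinates apply.
  set F : ℝ → ℝ≥0∞ := (Ioo 0 a).indicator fun r => ENNReal.ofReal (r ^ (-q)) *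
    (K * (2 * V r + 2 * ENNReal.ofReal (r ^ (p - 1)) * ∫⁻ s in Ioo (r / 2) r, Γ s)) with hF
  have hFm : Measurable F := by
    refine Measurable.indicator ?_ measurableSet_Ioo
    fun_prop
  have hswap : ∫⁻ x : RSpace d, ∫⁻ h in Metric.ball (0 : RSpace d) a,
        ‖f (x + h) - f x‖ₑ ^ p / ‖h‖ₑ ^ q =
      ∫⁻ h in Metric.ball (0 : RSpace d) a, ∫⁻ x, ‖f (x + h) - f x‖ₑ ^ p / ‖h‖ₑ ^ q := by
    refine lintegral_lintegral_swap (Measurable.aemeasurable ?_)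
    simp only [Function.uncurry_def]
    fun_prop
  have hne : ∀ᵐ h : RSpace d, h ≠ 0 := by
    have : Nonempty (Fin d) := ⟨⟨0, hd⟩⟩
    simp [ae_iff]
  calc _ = _ := hswap
    _ ≤ ∫⁻ h in Metric.ball (0 : RSpace d) a, F ‖h‖ := by
        refine lintegral_mono_ae ?_
        filter_upwards [ae_restrict_of_ae hne, ae_restrict_mem measurableSet_ball] with h h0 hball
        have hpos : 0 < ‖h‖ := norm_pos_iff.2 h0
        have hlt : ‖h‖ < a := by simpa using hball
        have hinv : (‖h‖ₑ ^ q)⁻¹ = ENNReal.ofReal (‖h‖ ^ (-q)) := by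
          rw [← ENNReal.ofReal_rpow_of_pos hpos, ofReal_norm, ENNReal.rpow_neg]
        simp only [div_eq_mul_inv, hinv]
        rw [lintegral_mul_const _ (by fun_prop), mul_comm, hF,
          indicator_of_mem (show ‖h‖ ∈ Ioo 0 a from ⟨hpos, hlt⟩)]
        gcongr
        exact lintegral_translate_sub_le hp hw hG hvert h hpos hlt
          (hhor h _ _ (by positivity) hlt.le)
    _ ≤ ∫⁻ h, F ‖h‖ := lintegral_mono' Measure.restrict_le_self le_rfl
    _ = K₀ * ∫⁻ r in Ioi (0 : ℝ), ENNReal.ofReal (r ^ (d - 1)) * F r := hpolar F hFm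
    _ = K₀ * ∫⁻ r in Ioo (0 : ℝ) a, K * (2 * (ENNReal.ofReal (r ^ (-p)) * V r) +
          2 * (ENNReal.ofReal r⁻¹ * ∫⁻ s in Ioo (r / 2) r, Γ s)) := by
        congr 1
        have e : ∀ r : ℝ, ENNReal.ofReal (r ^ (d - 1)) * F r = (Ioo 0 a).indicator
            (fun r => ENNReal.ofReal (r ^ (d - 1)) * (ENNReal.ofReal (r ^ (-q)) *
    (K * (2 * V r + 2 * ENNReal.ofReal (r ^ (p - 1)) * ∫⁻ s in Ioo (r / 2) r, Γ s)))) r := by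
          intro r
          simp only [hF, indicator_apply]
          split_ifs <;> simp
        simp_rw [e]
        rw [lintegral_indicator measurableSet_Ioo, Measure.restrict_restrict measurableSet_Ioo,
          inter_eq_left.2 (fun r hr => hr.1)]
        refine setLIntegral_congr_fun measurableSet_Ioo fun r hr => ?_
        -- Since $q = p-1+d$, the Jacobian $r^{d-1}$ and the singular weight combine to $r^{-p}$,
        -- the Hardy weight. On the horizontal term the extra $r^{p-1}$ reduces this to $r^{-1}$.
        have h1 : ENNReal.ofReal (r ^ (d - 1)) * ENNReal.ofReal (r ^ (-q)) =
            ENNReal.ofReal (r ^ (-p)) := by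
          rw [← ENNReal.ofReal_mul (pow_nonneg hr.1.le _), ← Real.rpow_natCast,
            ← Real.rpow_add hr.1, Nat.cast_sub hd, hq']
          congr 2
          push_cast
          ring
        have h2 : ENNReal.ofReal (r ^ (-p)) * ENNReal.ofReal (r ^ (p - 1)) =
            ENNReal.ofReal r⁻¹ := by
          rw [← ENNReal.ofReal_mul (Real.rpow_nonneg hr.1.le _), ← Real.rpow_add hr.1,
            ← Real.rpow_neg_one]
          congr 2
          ring
        rw [← mul_assoc, h1, ← h2]
        ring
    _ = K₀ * (K * (2 * (∫⁻ r in Ioo (0 : ℝ) a, ENNReal.ofReal (r ^ (-p)) * V r) +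
          2 * ∫⁻ r in Ioo (0 : ℝ) a, ENNReal.ofReal r⁻¹ * ∫⁻ s in Ioo (r / 2) r, Γ s)) := by
        rw [lintegral_const_mul _ (by fun_prop), lintegral_add_left (by fun_prop),
          lintegral_const_mul _ (by fun_prop), lintegral_const_mul _ (by fun_prop)]
    _ ≤ K₀ * (K * (2 * (ENNReal.ofReal (2 ^ p / (p - 1)) * ∫⁻ r in Ioo 0 a, Γ r) +
          2 * ∫⁻ r in Ioo 0 a, Γ r)) := by
        refine mul_le_mul_right (mul_le_mul_right (add_le_add (mul_le_mul_right ?_ _)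
          (mul_le_mul_right ?_ _)) _) _
        · have hmeas : Measurable fun z : ℝ × RSpace d =>
              ENNReal.ofReal (z.1 ^ (-p)) * (∫⁻ s in Ioo 0 z.1, G z.2 s) ^ p := by
            refine Measurable.mul (by fun_prop) ?_
            exact ((measurable_lintegral_Ioo hG (measurable_const (a := (0 : ℝ)))).pow_const p).comp
              measurable_swap
          have hmeas2 : Measurable fun z : RSpace d × ℝ => G z.1 z.2 ^ p := hG.pow_const p
          calc ∫⁻ r in Ioo 0 a, ENNReal.ofReal (r ^ (-p)) * V r
              = ∫⁻ r in Ioo 0 a, ∫⁻ x, ENNReal.ofReal (r ^ (-p)) *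
                  (∫⁻ s in Ioo 0 r, G x s) ^ p := by
                refine lintegral_congr fun r => ?_
                rw [lintegral_const_mul]
                have h1 : Measurable fun x => ∫⁻ s in Ioo 0 r, G x s := hG.lintegral_prod_right'
                exact h1.pow_const p
            _ = ∫⁻ x, ∫⁻ r in Ioo 0 a, ENNReal.ofReal (r ^ (-p)) *
                  (∫⁻ s in Ioo 0 r, G x s) ^ p :=
                lintegral_lintegral_swap hmeas.aemeasurable
            _ ≤ ∫⁻ x, ENNReal.ofReal (2 ^ p / (p - 1)) * ∫⁻ r in Ioo 0 a, G x r ^ p :=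
                lintegral_mono fun x => hardy_Ioo hp (hG.comp measurable_prodMk_left) a
            _ = ENNReal.ofReal (2 ^ p / (p - 1)) * ∫⁻ x, ∫⁻ r in Ioo 0 a, G x r ^ p :=
                lintegral_const_mul _ hmeas2.lintegral_prod_right'
            _ = _ := by rw [lintegral_lintegral_swap hmeas2.aemeasurable]
        · exact lintegral_Ioo_inv_mul_lintegral_le hΓm a
    _ = _ := by ring

end

/-! ### Differences as integrals of weak derivatives -/

section


variable {n : ℕ}

theorem IsLocLp.integrableOn {S K : Set (RSpace n)} {f : RSpace n → ℝ}
    (hf : IsLocLp 1 volume S f) (hK : IsCompact K) (hKS : K ⊆ S) : IntegrableOn f K :=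
  memLp_one_iff_integrable.1 (hf K hK hKS)

/-- The compact set swept out by translating `K` along a segment. -/
theorem isCompact_sweep {K : Set (RSpace n)} (hK : IsCompact K) (h : RSpace n) :
    IsCompact ((fun z : ℝ × RSpace n => z.2 + z.1 • h) '' (Icc 0 1 ×ˢ K)) :=
  (isCompact_Icc.prod hK).image (by fun_prop)

/-- For each fixed $\theta$ the map is a translation. Composing with the shear gives joint
integrability of $g(x+\theta h)$, as needed for Fubini. -/
theorem measurePreserving_shear (h : RSpace n) (μ : Measure ℝ) [SFinite μ] :
    MeasurePreserving (fun z : ℝ × RSpace n => (z.1, z.2 + z.1 • h))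
      (μ.prod volume) (μ.prod volume) :=
  (MeasurePreserving.id μ).skew_product (g := fun θ x => x + θ • h) (by fun_prop)
    (Filter.Eventually.of_forall fun θ =>
      (measurePreserving_add_right (volume : Measure (RSpace n)) (θ • h)).map_eq)

/-- Fubini's theorem for a translated integrable function against a continuous compactly supported
function. -/
theorem integral_mul_integral_translate {g φ : RSpace n → ℝ} (hg : Integrable g)
    (hφ : Continuous φ) (hφc : HasCompactSupport φ) (h : RSpace n) :
    ∫ x, (∫ θ in Icc (0 : ℝ) 1, g (x + θ • h)) * φ x =
      ∫ θ in Icc (0 : ℝ) 1, ∫ y, g y * φ (y - θ • h) := by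
  obtain ⟨C, hC⟩ := hφc.exists_bound_of_continuous hφ
  have h1 : Integrable (fun z : ℝ × RSpace n => g z.2 * φ (z.2 - z.1 • h))
      ((volume.restrict (Icc (0 : ℝ) 1)).prod volume) :=
    (hg.comp_snd _).mul_bdd (c := C) (by fun_prop) (Filter.Eventually.of_forall fun z => hC _)
  have h2 : Integrable (fun z : ℝ × RSpace n => g (z.2 + z.1 • h) * φ z.2)
      ((volume.restrict (Icc (0 : ℝ) 1)).prod volume) := by
    have := (measurePreserving_shear h (volume.restrict (Icc (0 : ℝ) 1))).integrable_comp_of_integrable h1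
    simpa [Function.comp_def] using this
  calc _ = ∫ x, ∫ θ in Icc (0 : ℝ) 1, g (x + θ • h) * φ x := by simp_rw [integral_mul_const]
    _ = ∫ θ in Icc (0 : ℝ) 1, ∫ x, g (x + θ • h) * φ x := (integral_integral_swap h2).symm
    _ = _ := by
      congr 1 with θ
      rw [← integral_add_right_eq_self (fun y => g y * φ (y - θ • h)) (θ • h)]
      simp

theorem integrable_integral_translate {g : RSpace n → ℝ} (hg : Integrable g) (h : RSpace n) :
    Integrable fun x => ∫ θ in Icc (0 : ℝ) 1, g (x + θ • h) := by
  have := (measurePreserving_shear h (volume.restrict (Icc (0 : ℝ) 1))).integrable_comp_of_integrable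
    (hg.comp_snd (volume.restrict (Icc (0 : ℝ) 1)))
  exact this.integral_prod_right

/-- A function with a weak directional derivative is, along almost every segment in that direction,
an integral of the derivative. -/
theorem ae_sub_eq_integral_of_weak {U V : Set (RSpace n)} (hU : IsOpen U) (hV : IsOpen V)
    {h : RSpace n} (hUV : ∀ x ∈ V, ∀ θ ∈ Icc (0 : ℝ) 1, x + θ • h ∈ U)
    {u g : RSpace n → ℝ} (hu : IsLocLp 1 volume U u) (hg : IsLocLp 1 volume U g)
    (hweak : ∀ φ : RSpace n → ℝ, ContDiff ℝ ∞ φ → HasCompactSupport φ → tsupport φ ⊆ U →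
      ∫ x in U, u x * fderiv ℝ φ x h = -∫ x in U, g x * φ x) :
    ∀ᵐ x, x ∈ V → u (x + h) - u x - ∫ θ in Icc (0 : ℝ) 1, g (x + θ • h) = 0 := by
  -- `S K` is the compact set swept out by the segments starting in `K`. Truncating $u$ and $g$ to
  -- it yields globally integrable functions, so translation invariance and Fubini become available
  -- without changing anything seen from `K`.
  set S : Set (RSpace n) → Set (RSpace n) := fun K =>
    (fun z : ℝ × RSpace n => z.2 + z.1 • h) '' (Icc 0 1 ×ˢ K) with hS
  have hSc : ∀ K, IsCompact K → IsCompact (S K) := fun K hK => isCompact_sweep hK h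
  have hSU : ∀ K, K ⊆ V → S K ⊆ U := by
    rintro K hK _ ⟨z, hz, rfl⟩
    exact hUV _ (hK hz.2) _ hz.1
  have hmem : ∀ K, ∀ x ∈ K, ∀ θ ∈ Icc (0 : ℝ) 1, x + θ • h ∈ S K := fun K x hx θ hθ =>
    ⟨(θ, x), ⟨hθ, hx⟩, rfl⟩
  have hind : ∀ K, IsCompact K → K ⊆ V → ∀ f : RSpace n → ℝ, IsLocLp 1 volume U f →
      Integrable ((S K).indicator f) := fun K hK hKV f hf =>
    (integrable_indicator_iff (hSc K hK).measurableSet).2 (hf.integrableOn (hSc K hK) (hSU K hKV))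
  -- on `K`, the function agrees with one built from integrable functions
  have hcongr : ∀ K, ∀ x ∈ K, u (x + h) - u x - ∫ θ in Icc (0 : ℝ) 1, g (x + θ • h) =
      (S K).indicator u (x + h) - (S K).indicator u x -
        ∫ θ in Icc (0 : ℝ) 1, (S K).indicator g (x + θ • h) := by
    intro K x hx
    have e0 := hmem K x hx 0 (by simp)
    have e1 := hmem K x hx 1 (by simp)
    simp only [zero_smul, add_zero, one_smul] at e0 e1
    rw [indicator_of_mem e0, indicator_of_mem e1]
    congr 1
    refine setIntegral_congr_fun measurableSet_Icc fun θ hθ => ?_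
    rw [indicator_of_mem (hmem K x hx θ hθ)]
  have hint : ∀ K, IsCompact K → K ⊆ V → Integrable fun x => (S K).indicator u (x + h) -
      (S K).indicator u x - ∫ θ in Icc (0 : ℝ) 1, (S K).indicator g (x + θ • h) := by
    intro K hK hKV
    exact (((hind K hK hKV u hu).comp_add_right h).sub (hind K hK hKV u hu)).sub
      (integrable_integral_translate (hind K hK hKV g hg) h)
  -- By the fundamental lemma of the calculus of variations it suffices to test against smooth
  -- $\varphi$ supported in $V$.
  refine hV.ae_eq_zero_of_integral_contDiff_smul_eq_zero ?_ ?_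
  · rw [locallyIntegrableOn_iff hV.isLocallyClosed]
    intro K hKV hK
    exact (hint K hK hKV).integrableOn.congr_fun (fun x hx => (hcongr K x hx).symm) hK.measurableSet
  intro φ hφ hφc hφV
  set K := tsupport φ with hKdef
  have hK : IsCompact K := hφc
  have hφ0 : ∀ x, x ∉ K → φ x = 0 := fun x hx => image_eq_zero_of_notMem_tsupport hx
  set uK := (S K).indicator u
  set gK := (S K).indicator g
  have huK : Integrable uK := hind K hK hφV u hu
  have hgK : Integrable gK := hind K hK hφV g hg
  set φt : ℝ → RSpace n → ℝ := fun θ y => φ (y - θ • h) with hφt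
  have hφtd : ∀ θ, ContDiff ℝ ∞ (φt θ) := fun θ => hφ.comp (contDiff_id.sub contDiff_const)
  have hφts : ∀ θ ∈ Icc (0 : ℝ) 1, tsupport (φt θ) ⊆ S K := by
    intro θ hθ
    refine closure_minimal (fun y hy => ?_) (hSc K hK).isClosed
    have : y - θ • h ∈ K := subset_tsupport _ hy
    simpa using hmem K _ this θ hθ
  have hφtc : ∀ θ ∈ Icc (0 : ℝ) 1, HasCompactSupport (φt θ) := fun θ hθ =>
    (hSc K hK).of_isClosed_subset (isClosed_tsupport _) (hφts θ hθ)
  have hfd : ∀ θ y, fderiv ℝ (φt θ) y = fderiv ℝ φ (y - θ • h) := fun θ y => by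
    simp only [hφt, sub_eq_add_neg]
    exact fderiv_comp_add_right (f := φ) (x := y) (-(θ • h))
  have hDcont : Continuous (fderiv ℝ φ) := hφ.continuous_fderiv (by simp)
  -- the weak identity for translates, written with integrals over the whole space
  have hw : ∀ θ ∈ Icc (0 : ℝ) 1, ∫ y, uK y * fderiv ℝ φ (y - θ • h) h = -∫ y, gK y * φt θ y := by
    intro θ hθ
    have := hweak (φt θ) (hφtd θ) (hφtc θ hθ) ((hφts θ hθ).trans (hSU K hφV))
    have ext : ∀ f ψ : RSpace n → ℝ, (∀ y, y ∉ S K → ψ y = 0) →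
        ∫ y in U, f y * ψ y = ∫ y, (S K).indicator f y * ψ y := by
      intro f ψ hψ
      rw [← integral_indicator hU.measurableSet]
      congr 1 with y
      by_cases hy : y ∈ S K
      · simp [hy, hSU K hφV hy]
      · simp [hy, hψ y hy]
    rw [ext, ext] at this
    · simpa only [hfd] using this
    · exact fun y hy => image_eq_zero_of_notMem_tsupport fun hy' => hy (hφts θ hθ hy')
    · intro y hy
      have h0 : fderiv ℝ (φt θ) y = 0 :=
        image_eq_zero_of_notMem_tsupport fun hy' =>
          hy (hφts θ hθ (tsupport_fderiv_subset ℝ hy'))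
      rw [h0]; rfl
  have hftc : ∀ y, φ (y - h) - φ y = -∫ θ in Icc (0 : ℝ) 1, fderiv ℝ φ (y - θ • h) h := by
    intro y
    have hd : ∀ θ ∈ uIcc (0 : ℝ) 1, HasDerivAt (fun θ : ℝ => φ (y - θ • h))
        (-(fderiv ℝ φ (y - θ • h) h)) θ := by
      intro θ _
      have h1 : HasDerivAt (fun θ : ℝ => y - θ • h) (-h) θ := by
        simpa using ((hasDerivAt_id θ).smul_const h).const_sub y
      have h2 := ((hφ.differentiable (by simp)) (y - θ • h)).hasFDerivAt.comp_hasDerivAt θ h1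
      simpa [Function.comp_def] using h2
    have := intervalIntegral.integral_eq_sub_of_hasDerivAt hd
      (Continuous.intervalIntegrable (by fun_prop) _ _)
    rw [intervalIntegral.integral_of_le zero_le_one, ← integral_Icc_eq_integral_Ioc,
      integral_neg] at this
    simpa using this.symm
  obtain ⟨C, hC⟩ := (hφc.fderiv (𝕜 := ℝ)).exists_bound_of_continuous hDcont
  have hjoint : Integrable (fun z : ℝ × RSpace n => uK z.2 * fderiv ℝ φ (z.2 - z.1 • h) h)
      ((volume.restrict (Icc (0 : ℝ) 1)).prod volume) := by
    refine (huK.comp_snd _).mul_bdd (c := C * ‖h‖) ?_ (Filter.Eventually.of_forall fun z => ?_)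
    · have : Continuous fun z : ℝ × RSpace n => fderiv ℝ φ (z.2 - z.1 • h) h := by fun_prop
      exact this.aestronglyMeasurable
    · exact (ContinuousLinearMap.le_opNorm _ _).trans
        (mul_le_mul_of_nonneg_right (hC _) (norm_nonneg _))
  obtain ⟨C', hC'⟩ := hφc.exists_bound_of_continuous hφ.continuous
  have hI1 : Integrable fun x => uK (x + h) * φ x := (huK.comp_add_right h).mul_bdd (c := C')
    hφ.continuous.aestronglyMeasurable (Filter.Eventually.of_forall hC')
  have hI2 : Integrable fun x => uK x * φ x := huK.mul_bdd (c := C')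
    hφ.continuous.aestronglyMeasurable (Filter.Eventually.of_forall hC')
  have hI1' : Integrable fun x => uK x * φ (x - h) := huK.mul_bdd (c := C')
    (by have := hφ.continuous; fun_prop) (Filter.Eventually.of_forall fun x => hC' _)
  have hI3 : Integrable fun x => (∫ θ in Icc (0 : ℝ) 1, gK (x + θ • h)) * φ x :=
    (integrable_integral_translate hgK h).mul_bdd (c := C')
      hφ.continuous.aestronglyMeasurable (Filter.Eventually.of_forall hC')
  have hleft : ∫ x, uK (x + h) * φ x - uK x * φ x =
      ∫ θ in Icc (0 : ℝ) 1, ∫ y, gK y * φ (y - θ • h) := by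
    rw [integral_sub hI1 hI2]
    have e1 : ∫ x, uK (x + h) * φ x = ∫ x, uK x * φ (x - h) := by
      -- The shift is moved from $u$ to $\varphi$. Then $\varphi(x-h)-\varphi(x)$ is the integral
      -- over $\theta$ of directional derivatives of translates of $\varphi$, and the weak identity
      -- for each translate replaces $u$ by $g$.
      rw [← integral_add_right_eq_self (fun x => uK x * φ (x - h)) h]
      simp
    rw [e1, ← integral_sub hI1' hI2]
    calc ∫ x, uK x * φ (x - h) - uK x * φ x
        = ∫ x, -∫ θ in Icc (0 : ℝ) 1, uK x * fderiv ℝ φ (x - θ • h) h := by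
          congr 1 with x
          rw [← mul_sub, hftc, integral_const_mul, mul_neg]
      _ = -∫ θ in Icc (0 : ℝ) 1, ∫ x, uK x * fderiv ℝ φ (x - θ • h) h := by
          rw [integral_neg, ← integral_integral_swap hjoint]
      _ = _ := by
          rw [← integral_neg]
          refine setIntegral_congr_fun measurableSet_Icc fun θ hθ => ?_
          rw [hw θ hθ, neg_neg]
  have hzero : ∀ x, φ x • (u (x + h) - u x - ∫ θ in Icc (0 : ℝ) 1, g (x + θ • h)) =
      (uK (x + h) * φ x - uK x * φ x) - (∫ θ in Icc (0 : ℝ) 1, gK (x + θ • h)) * φ x := by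
    intro x
    by_cases hx : x ∈ K
    · rw [hcongr K x hx, smul_eq_mul]; ring
    · simp [hφ0 x hx]
  simp_rw [hzero]
  have hI12 : Integrable fun x => uK (x + h) * φ x - uK x * φ x := hI1.sub hI2
  rw [integral_sub hI12 hI3, hleft,
    integral_mul_integral_translate hgK hφ.continuous hφc, sub_self]

end

/-! ### Coordinates on the strip -/

section


variable {d : ℕ}

@[simp] theorem consLast_last (x : RSpace d) (t : ℝ) : consLast x t (Fin.last d) = t := by
  simp [consLast]

@[simp] theorem consLast_castSucc (x : RSpace d) (t : ℝ) (i : Fin d) :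
    consLast x t i.castSucc = x i := by
  simp [consLast]

/-- The horizontal part of a point. -/
noncomputable def horiz (y : RSpace (d + 1)) : RSpace d := WithLp.toLp 2 fun i => y i.castSucc

@[simp] theorem horiz_consLast (x : RSpace d) (t : ℝ) : horiz (consLast x t) = x := by
  ext i; simp [horiz]

@[simp] theorem consLast_horiz (y : RSpace (d + 1)) : consLast (horiz y) (y (Fin.last d)) = y := by
  ext i
  refine Fin.lastCases ?_ (fun i => ?_) i
  · simp
  · simp [horiz]

theorem consLast_add (x y : RSpace d) (s t : ℝ) :
    consLast (x + y) (s + t) = consLast x s + consLast y t := by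
  ext i
  refine Fin.lastCases ?_ (fun i => ?_) i <;> simp

theorem consLast_smul (c : ℝ) (x : RSpace d) (t : ℝ) :
    consLast (c • x) (c * t) = c • consLast x t := by
  ext i
  refine Fin.lastCases ?_ (fun i => ?_) i <;> simp

theorem consLast_zero (t : ℝ) :
    consLast (0 : RSpace d) t = t • EuclideanSpace.single (Fin.last d) 1 := by
  ext i
  refine Fin.lastCases ?_ (fun i => ?_) i
  · simp
  · simp [(Fin.castSucc_lt_last i).ne]

theorem continuous_consLast : Continuous fun z : RSpace d × ℝ => consLast z.1 z.2 := by
  refine (PiLp.continuous_toLp 2 _).comp (continuous_pi fun i => ?_)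
  refine Fin.lastCases ?_ (fun i => ?_) i
  · simpa using continuous_snd
  · simp only [Fin.snoc_castSucc]; fun_prop

theorem continuous_horiz : Continuous (horiz (d := d)) := by
  unfold horiz
  fun_prop

/-- `ℝ^d × ℝ ≃ ℝ^{d+1}`. -/
noncomputable def consLastEquiv (d : ℕ) : RSpace d × ℝ ≃ᵐ RSpace (d + 1) where
  toFun z := consLast z.1 z.2
  invFun y := (horiz y, y (Fin.last d))
  left_inv z := by simp
  right_inv y := by simp
  measurable_toFun := continuous_consLast.measurable
  measurable_invFun := by
    have := (continuous_horiz (d := d)).measurable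
    exact this.prodMk (by fun_prop)

@[simp] theorem consLastEquiv_apply (z : RSpace d × ℝ) : consLastEquiv d z = consLast z.1 z.2 := rfl

theorem measurePreserving_consLast :
    MeasurePreserving (consLastEquiv d) (volume.prod volume) volume := by
  have h1 := (PiLp.volume_preserving_toLp (Fin (d + 1))).comp
    ((volume_preserving_piFinSuccAbove (fun _ : Fin (d + 1) => ℝ) (Fin.last d)).symm.comp
      (((MeasurePreserving.id (volume : Measure ℝ)).prod
        (PiLp.volume_preserving_ofLp (Fin d))).comp
          (Measure.measurePreserving_swap (μ := (volume : Measure (RSpace d))) (ν := volume))))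
  -- The composite of the standard measure-preserving maps equals `consLastEquiv` only after
  -- comparing coordinates, so the property is transported along that equality.
  refine (congrArg (fun f => MeasurePreserving f (volume.prod volume) volume) ?_).mp h1
  funext z
  ext i
  refine Fin.lastCases ?_ (fun i => ?_) i <;>
    simp [MeasurableEquiv.piFinSuccAbove_symm_apply, Fin.insertNthEquiv]

theorem norm_consLast_zero (x : RSpace d) : ‖consLast x 0‖ = ‖x‖ := by
  simp [EuclideanSpace.norm_eq, Fin.sum_univ_castSucc]

theorem isometry_consLast (b : ℝ) : Isometry fun x : RSpace d => consLast x b := by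
  refine Isometry.of_dist_eq fun x y => ?_
  rw [dist_eq_norm, dist_eq_norm, ← norm_consLast_zero (x - y)]
  congr 1
  ext i
  refine Fin.lastCases ?_ (fun i => ?_) i <;> simp

theorem isOpen_strip (bm bp : ℝ) : IsOpen (strip d bm bp) :=
  (isOpen_lt (g := fun x : RSpace (d + 1) => x (Fin.last d)) continuous_const (by fun_prop)).inter
    (isOpen_lt (f := fun x : RSpace (d + 1) => x (Fin.last d)) (by fun_prop) continuous_const)

@[simp] theorem consLast_mem_strip {bm bp : ℝ} {x : RSpace d} {t : ℝ} :
    consLast x t ∈ strip d bm bp ↔ t ∈ Ioo bm bp := by simp [strip]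

theorem fderiv_apply_eq_sum {n : ℕ} (φ : RSpace n → ℝ) (x h : RSpace n) :
    fderiv ℝ φ x h = ∑ i, h i * classicalPartial i φ x := by
  have : h = ∑ i, h i • EuclideanSpace.single i (1 : ℝ) := by
    ext j
    simp [Finset.sum_apply, Pi.single_apply]
  conv_lhs => rw [this]
  simp [classicalPartial]

/-- The weak directional derivative as a combination of weak partial derivatives. -/
theorem setIntegral_mul_fderiv_eq {n : ℕ} {U : Set (RSpace n)} {u : RSpace n → ℝ}
    {g : Fin n → RSpace n → ℝ} (hu : IsLocLp 1 volume U u)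
    (hg : ∀ i, IsWeakPartial U i u (g i)) (h : RSpace n) {φ : RSpace n → ℝ} (hφ : ContDiff ℝ ∞ φ)
    (hφc : HasCompactSupport φ) (hφU : tsupport φ ⊆ U) :
    ∫ x in U, u x * fderiv ℝ φ x h = -∫ x in U, (∑ i, h i * g i x) * φ x := by
  have e1 : ∀ x, u x * fderiv ℝ φ x h = ∑ i, h i * (u x * classicalPartial i φ x) := fun x => by
    rw [fderiv_apply_eq_sum, Finset.mul_sum]
    exact Finset.sum_congr rfl fun i _ => by ring
  have e2 : ∀ x, (∑ i, h i * g i x) * φ x = ∑ i, h i * (g i x * φ x) := fun x => by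
    rw [Finset.sum_mul]
    exact Finset.sum_congr rfl fun i _ => by ring
  simp_rw [e1, e2]
  rw [integral_finsetSum, integral_finsetSum, ← Finset.sum_neg_distrib]
  · refine Finset.sum_congr rfl fun i _ => ?_
    rw [integral_const_mul, integral_const_mul, (hg i).2 φ hφ hφc hφU]
    ring
  · exact fun i _ => ((hg i).1.integrableOn_mul hφ.continuous hφc hφU).const_mul _
  · exact fun i _ => (hu.integrableOn_mul (continuous_classicalPartial hφ i)
      (hasCompactSupport_classicalPartial hφc i)
      ((tsupport_classicalPartial φ i).trans hφU)).const_mul _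

theorem IsLocLp.sum_mul {n : ℕ} {U : Set (RSpace n)} {g : Fin n → RSpace n → ℝ}
    (hg : ∀ i, IsLocLp 1 volume U (g i)) (h : RSpace n) :
    IsLocLp 1 volume U fun x => ∑ i, h i * g i x := fun K hK hKU =>
  memLp_finsetSum _ fun i _ => (hg i K hK hKU).const_mul (h i)

/-- In the strip, differences of a function with weak partial derivatives are integrals of the
directional derivative. -/
theorem ae_strip_sub_eq_integral {bm bp : ℝ} {u : RSpace (d + 1) → ℝ}
    {g : Fin (d + 1) → RSpace (d + 1) → ℝ} (hu : IsLocLp 1 volume (strip d bm bp) u)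
    (hg : ∀ i, IsWeakPartial (strip d bm bp) i u (g i)) (h : RSpace (d + 1)) :
    ∀ᵐ x, x ∈ strip d bm bp → x + h ∈ strip d bm bp →
      u (x + h) - u x = ∫ θ in Icc (0 : ℝ) 1, ∑ i, h i * g i (x + θ • h) := by
  have hV : IsOpen {x | x ∈ strip d bm bp ∧ x + h ∈ strip d bm bp} :=
    (isOpen_strip bm bp).inter ((isOpen_strip bm bp).preimage (continuous_add_const h))
  have := ae_sub_eq_integral_of_weak (isOpen_strip bm bp) hV (h := h) ?_ hu
    (IsLocLp.sum_mul (fun i => (hg i).1) h)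
    (fun φ h1 h2 h3 => setIntegral_mul_fderiv_eq hu hg h h1 h2 h3)
  · filter_upwards [this] with x hx h1 h2
    exact sub_eq_zero.1 (hx ⟨h1, h2⟩)
  · rintro x ⟨h1, h2⟩ θ ⟨h3, h4⟩
    simp only [strip, mem_ofPred_eq, PiLp.add_apply, PiLp.smul_apply, smul_eq_mul] at h1 h2 ⊢
    rcases h3.eq_or_lt with rfl | h3
    · simpa using h1
    · constructor
      · nlinarith [mul_pos h3 (sub_pos.2 h2.1), mul_nonneg (sub_nonneg.2 h4) (sub_pos.2 h1.1).le]
      · nlinarith [mul_pos h3 (sub_pos.2 h2.2), mul_nonneg (sub_nonneg.2 h4) (sub_pos.2 h1.2).le]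

end

/-! ### Primitives along vertical lines -/

section


variable {d : ℕ}

theorem intervalIntegrable_of_mem_Icc {g : ℝ → ℝ} {a b s t : ℝ} (hg : IntegrableOn g (Ioo a b))
    (hs : s ∈ Icc a b) (ht : t ∈ Icc a b) : IntervalIntegrable g volume s t := by
  have hab : a ≤ b := hs.1.trans hs.2
  have h := (intervalIntegrable_iff_integrableOn_Ioo_of_le hab).2 hg
  refine h.mono_set ?_
  rw [uIcc_of_le hab]
  exact uIcc_subset_Icc hs ht

/-- If almost all vertical differences of `u` are integrals of `g`, then almost every vertical
restriction of `u` is a primitive of `g`. -/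
theorem exists_vertical_primitive {bm bp : ℝ} (hab : bm < bp) {u g : RSpace d → ℝ → ℝ}
    (hu : Measurable (Function.uncurry u)) (hg : Measurable (Function.uncurry g))
    (hgi : ∀ᵐ x, IntegrableOn (g x) (Ioo bm bp))
    (hdiff : ∀ τ : ℝ, ∀ᵐ z : RSpace d × ℝ, z.2 ∈ Ioo bm bp → z.2 + τ ∈ Ioo bm bp →
      u z.1 (z.2 + τ) - u z.1 z.2 = ∫ s in z.2..z.2 + τ, g z.1 s) :
    ∃ f : RSpace d → ℝ, Measurable f ∧ ∀ᵐ x, ∀ᵐ t ∂volume.restrict (Ioo bm bp),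
      u x t = f x + ∫ s in bm..t, g x s := by
  set I := Ioo bm bp with hI
  -- This should not depend on the height. The set integral over `Ioc` agrees with the interval
  -- integral for heights in $I$, and is the parameter integral of an indicator, hence jointly
  -- measurable.
  set v : RSpace d × ℝ → ℝ := fun z => u z.1 z.2 - ∫ s in Ioc bm z.2, g z.1 s with hv
  have hvm : Measurable v := by
    refine Measurable.sub hu ?_
    have h1 : MeasurableSet {y : (RSpace d × ℝ) × ℝ | bm < y.2 ∧ y.2 ≤ y.1.2} :=
      (measurableSet_lt measurable_const measurable_snd).inter
        (measurableSet_le measurable_snd (g := fun y : (RSpace d × ℝ) × ℝ => y.1.2) (by fun_prop))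
    have h2 : Measurable fun y : (RSpace d × ℝ) × ℝ => g y.1.1 y.2 :=
      hg.comp (by fun_prop : Measurable fun y : (RSpace d × ℝ) × ℝ => (y.1.1, y.2))
    have h3 := ((h2.indicator h1).stronglyMeasurable.integral_prod_right'
      (ν := (volume : Measure ℝ))).measurable
    convert h3 using 2 with z
    rw [← integral_indicator measurableSet_Ioc]
    rfl
  have hprim : ∀ x t, t ∈ I → ∫ s in Ioc bm t, g x s = ∫ s in bm..t, g x s := fun x t ht =>
    (intervalIntegral.integral_of_le ht.1.le).symm
  have hshift : ∀ τ : ℝ, ∀ᵐ z : RSpace d × ℝ, z.2 ∈ I → z.2 + τ ∈ I → v (z.1, z.2 + τ) = v z := by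
    intro τ
    have hgi' : ∀ᵐ z : RSpace d × ℝ, IntegrableOn (g z.1) I :=
      Measure.quasiMeasurePreserving_fst.ae hgi
    filter_upwards [hdiff τ, hgi'] with z hz hzi h1 h2
    have e := intervalIntegral.integral_interval_sub_left
      (intervalIntegrable_of_mem_Icc hzi (left_mem_Icc.2 hab.le) (Ioo_subset_Icc_self h2))
      (intervalIntegrable_of_mem_Icc hzi (left_mem_Icc.2 hab.le) (Ioo_subset_Icc_self h1))
    have hz' := hz h1 h2
    simp only [hv]
    rw [hprim _ _ h1, hprim _ _ h2]
    linarith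
  have hmI : MeasurableSet I := measurableSet_Ioo
  -- The exceptional null set of `hshift` depends on $\tau$. Fubini exchanges the quantifiers, and
  -- for this the joint measurability of $v$ is needed.
  have hall : ∀ᵐ z : RSpace d × ℝ, ∀ᵐ τ : ℝ, z.2 ∈ I → z.2 + τ ∈ I → v (z.1, z.2 + τ) = v z := by
    refine (Measure.ae_ae_comm (p := fun (τ : ℝ) (z : RSpace d × ℝ) =>
      z.2 ∈ I → z.2 + τ ∈ I → v (z.1, z.2 + τ) = v z) ?_).1 (Filter.Eventually.of_forall hshift)
    have m1 : MeasurableSet {y : ℝ × RSpace d × ℝ | y.2.2 ∈ I} :=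
      (by fun_prop : Measurable fun y : ℝ × RSpace d × ℝ => y.2.2) hmI
    have m2 : MeasurableSet {y : ℝ × RSpace d × ℝ | y.2.2 + y.1 ∈ I} :=
      (by fun_prop : Measurable fun y : ℝ × RSpace d × ℝ => y.2.2 + y.1) hmI
    have m3 : MeasurableSet {y : ℝ × RSpace d × ℝ | v (y.2.1, y.2.2 + y.1) = v y.2} :=
      measurableSet_eq_fun (hvm.comp (by fun_prop)) (hvm.comp measurable_snd)
    exact m1.imp (m2.imp m3)
  have hconst : ∀ᵐ x : RSpace d, ∀ᵐ t : ℝ, t ∈ I → ∀ᵐ t' : ℝ, t' ∈ I → v (x, t') = v (x, t) := by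
    filter_upwards [Measure.ae_ae_of_ae_prod hall] with x hx
    filter_upwards [hx] with t ht htI
    have := (quasiMeasurePreserving_add_right (volume : Measure ℝ) (-t)).ae ht
    filter_upwards [this] with t' ht'
    simpa [htI] using ht'
  -- The mean of $v(x,\cdot)$ is measurable in $x$ in any case, and it equals the a.e. constant
  -- value on almost every line.
  refine ⟨fun x => (bp - bm)⁻¹ * ∫ t in I, v (x, t), ?_, ?_⟩
  · exact (hvm.stronglyMeasurable.integral_prod_right'
      (ν := volume.restrict I)).measurable.const_mul _
  · filter_upwards [hconst] with x hx
    rw [ae_restrict_iff' measurableSet_Ioo]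
    filter_upwards [hx] with t ht htI
    have e : ∫ t' in I, v (x, t') = (bp - bm) * v (x, t) := by
      rw [setIntegral_congr_ae measurableSet_Ioo (ht htI)]
      simp [measureReal_def, ENNReal.toReal_ofReal (sub_pos.2 hab).le]
    rw [e, inv_mul_cancel_left₀ (sub_pos.2 hab).ne']
    simp only [hv]
    rw [hprim x t htI]
    ring

/-- Local integrability of the initial value of a family of vertical primitives. -/
theorem integrableOn_of_vertical_primitive {s₁ s₂ bm bp : ℝ} (hs : s₁ < s₂)
    (h₁ : bm < s₁) (h₂ : s₂ < bp) {u g : RSpace d → ℝ → ℝ} {f : RSpace d → ℝ}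
    (hf : Measurable f) {K : Set (RSpace d)}
    (hu : IntegrableOn (Function.uncurry u) (K ×ˢ Icc s₁ s₂))
    (hg : IntegrableOn (Function.uncurry g) (K ×ˢ Ioo bm bp))
    (hrep : ∀ᵐ x, ∀ᵐ t ∂volume.restrict (Ioo bm bp), u x t = f x + ∫ s in bm..t, g x s) :
    IntegrableOn f K := by
  have hsub : Icc s₁ s₂ ⊆ Ioo bm bp := fun t ht => ⟨h₁.trans_le ht.1, ht.2.trans_lt h₂⟩
  rw [IntegrableOn, Measure.volume_eq_prod, ← Measure.prod_restrict] at hu hg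
  have hA : Integrable (fun x => ∫ s in Ioo bm bp, ‖g x s‖) (volume.restrict K) :=
    hg.integral_norm_prod_left
  have hU : Integrable (fun x => ∫ s in Icc s₁ s₂, ‖u x s‖) (volume.restrict K) :=
    hu.integral_norm_prod_left
  have hgx := hg.prod_right_ae
  have hux := hu.prod_right_ae
  refine Integrable.mono' (g := fun x => (s₂ - s₁)⁻¹ * (∫ s in Icc s₁ s₂, ‖u x s‖) +
    ∫ s in Ioo bm bp, ‖g x s‖) ((hU.const_mul _).add hA) hf.aestronglyMeasurable ?_
  filter_upwards [hgx, hux, ae_restrict_of_ae hrep] with x hgx hux hx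
  have hgx : IntegrableOn (g x) (Ioo bm bp) := hgx
  -- $u$ is known to be integrable only away from the boundary. The initial value is therefore
  -- bounded using heights in an interior slab, and the bound is then averaged over those heights.
  have hb : ∀ᵐ t ∂volume.restrict (Icc s₁ s₂), ‖f x‖ ≤ ‖u x t‖ + ∫ s in Ioo bm bp, ‖g x s‖ := by
    filter_upwards [ae_mono (Measure.restrict_mono hsub le_rfl) hx,
      ae_restrict_mem measurableSet_Icc] with t ht htI
    have e : f x = u x t - ∫ s in bm..t, g x s := by rw [ht]; ring
    rw [e]
    refine (norm_sub_le _ _).trans (add_le_add le_rfl ?_)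
    rw [intervalIntegral.integral_of_le (hsub htI).1.le]
    refine (norm_integral_le_integral_norm _).trans ?_
    exact setIntegral_mono_set hgx.norm (Filter.Eventually.of_forall fun _ => norm_nonneg _)
      (LE.le.eventuallyLE (show Ioc bm t ⊆ Ioo bm bp from
        fun s hs => ⟨hs.1, hs.2.trans_lt (hsub htI).2⟩))
  have hpos : 0 < s₂ - s₁ := sub_pos.2 hs
  have := integral_mono_ae (integrable_const _) (hux.norm.add (integrable_const _)) hb
  have e1 : volume.real (Icc s₁ s₂) = s₂ - s₁ := by
    simp [measureReal_def, ENNReal.toReal_ofReal hpos.le]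
  simp only [Pi.add_apply] at this
  rw [integral_add hux.norm (integrable_const _)] at this
  simp only [integral_const, measureReal_restrict_apply_univ, e1, smul_eq_mul,
    Function.uncurry] at this
  rw [← mul_le_mul_iff_of_pos_left hpos, mul_add, mul_inv_cancel_left₀ hpos.ne']
  exact this

end

/-! ### Horizontal translations and the screened bound on the strip -/

section


variable {d : ℕ}

theorem rpow_lintegral_le {α : Type*} [MeasurableSpace α] {μ : Measure α} {p : ℝ} (hp : 1 < p)
    {f : α → ℝ≥0∞} (hf : AEMeasurable f μ) :
    (∫⁻ x, f x ∂μ) ^ p ≤ μ univ ^ (p - 1) * ∫⁻ x, f x ^ p ∂μ := by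
  have hp0 : 0 < p := by linarith
  have key := ENNReal.lintegral_mul_le_Lp_mul_Lq μ (Real.HolderConjugate.conjExponent hp) hf
    (g := fun _ => 1) aemeasurable_const
  simp only [Pi.mul_apply, mul_one, ENNReal.one_rpow, lintegral_const, one_mul] at key
  calc _ ≤ _ := ENNReal.rpow_le_rpow key hp0.le
    _ = _ := by
      have : p - 1 ≠ 0 := by linarith
      rw [ENNReal.mul_rpow_of_nonneg _ _ hp0.le, ← ENNReal.rpow_mul, ← ENNReal.rpow_mul, mul_comm,
        one_div_mul_cancel hp0.ne', ENNReal.rpow_one, Real.conjExponent]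
      congr 2
      field_simp

/-- Regular representatives of a function on the strip and of its weak partial derivatives. -/
structure IsSobolevPair (p bm bp : ℝ) (u : RSpace (d + 1) → ℝ)
    (g : Fin (d + 1) → RSpace (d + 1) → ℝ) : Prop where
  measurable : Measurable u
  measurable_partial : ∀ i, Measurable (g i)
  isLocLp : IsLocLp 1 volume (strip d bm bp) u
  memLp_partial : ∀ i, MemLp (g i) (ENNReal.ofReal p) (volume.restrict (strip d bm bp))
  isWeakPartial : ∀ i, IsWeakPartial (strip d bm bp) i u (g i)

/-- The vector field with components `g`. -/
noncomputable def fieldOf {n : ℕ} (g : Fin n → RSpace n → ℝ) (x : RSpace n) : RSpace n :=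
  WithLp.toLp 2 fun i => g i x

theorem measurable_fieldOf {n : ℕ} {g : Fin n → RSpace n → ℝ} (hg : ∀ i, Measurable (g i)) :
    Measurable (fieldOf g) :=
  (WithLp.measurable_toLp 2 _).comp (measurable_pi_lambda _ hg)

theorem enorm_le_enorm_fieldOf {n : ℕ} (g : Fin n → RSpace n → ℝ) (i : Fin n) (x : RSpace n) :
    ‖g i x‖ₑ ≤ ‖fieldOf g x‖ₑ := by
  rw [enorm_le_iff_norm_le]
  exact PiLp.norm_apply_le (fieldOf g x) i

theorem enorm_sum_mul_le {n : ℕ} (g : Fin n → RSpace n → ℝ) (h x : RSpace n) :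
    ‖∑ i, h i * g i x‖ₑ ≤ ‖h‖ₑ * ‖fieldOf g x‖ₑ := by
  rw [← enorm_norm h, ← enorm_norm (fieldOf g x), ← enorm_mul, enorm_le_iff_norm_le]
  have : ∑ i, h i * g i x = inner ℝ h (fieldOf g x) := by
    simp [PiLp.inner_apply, fieldOf, mul_comm]
  rw [this]
  refine (norm_inner_le_norm _ _).trans ?_
  simp

variable {p bm bp : ℝ} {u : RSpace (d + 1) → ℝ} {g : Fin (d + 1) → RSpace (d + 1) → ℝ}

theorem measurable_comp_consLast {β : Type*} [MeasurableSpace β] (F : RSpace (d + 1) → β)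
    (hF : Measurable F) : Measurable fun z : RSpace d × ℝ => F (consLast z.1 z.2) :=
  hF.comp continuous_consLast.measurable

/-- The horizontal translation estimate on slabs. -/
theorem IsSobolevPair.lintegral_horizontal_le (hp : 1 < p) (H : IsSobolevPair p bm bp u g)
    (h : RSpace d) {T : Set ℝ} (hT : MeasurableSet T) (hTI : T ⊆ Ioo bm bp) :
    ∫⁻ t in T, ∫⁻ x, ‖u (consLast (x + h) t) - u (consLast x t)‖ₑ ^ p ≤
      ‖h‖ₑ ^ p * ∫⁻ t in T, ∫⁻ x, ‖fieldOf g (consLast x t)‖ₑ ^ p := by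
  have hp0 : 0 < p := by linarith
  have hgm := measurable_fieldOf H.measurable_partial
  have hF : Measurable fun z : RSpace d × ℝ => ‖fieldOf g (consLast z.1 z.2)‖ₑ ^ p :=
    ((measurable_comp_consLast (fieldOf g) hgm).enorm).pow_const p
  have hF3 : Measurable fun y : (ℝ × RSpace d) × ℝ =>
      ‖fieldOf g (consLast (y.1.2 + y.2 • h) y.1.1)‖ₑ ^ p :=
    (hF.comp (by fun_prop : Measurable fun y : (ℝ × RSpace d) × ℝ =>
      (y.1.2 + y.2 • h, y.1.1)) :)
  have hdiff : ∀ᵐ z : RSpace d × ℝ, z.2 ∈ T →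
      ‖u (consLast (z.1 + h) z.2) - u (consLast z.1 z.2)‖ₑ ^ p ≤
        ‖h‖ₑ ^ p * ∫⁻ θ in Icc (0 : ℝ) 1, ‖fieldOf g (consLast (z.1 + θ • h) z.2)‖ₑ ^ p := by
    have := measurePreserving_consLast.quasiMeasurePreserving.ae
      (ae_strip_sub_eq_integral H.isLocLp H.isWeakPartial (consLast h 0))
    rw [← Measure.volume_eq_prod] at this
    filter_upwards [this] with z hz hzT
    have e : ∀ θ : ℝ, consLast z.1 z.2 + θ • consLast h 0 = consLast (z.1 + θ • h) z.2 := by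
      intro θ
      rw [← consLast_smul, ← consLast_add]
      simp
    have e1 := e 1
    rw [one_smul, one_smul] at e1
    simp only [consLastEquiv_apply, e, e1, consLast_mem_strip] at hz
    rw [hz (hTI hzT) (hTI hzT)]
    have hm : Measurable fun θ : ℝ => ‖fieldOf g (consLast (z.1 + θ • h) z.2)‖ₑ := by
      have := (measurable_comp_consLast (fieldOf g) hgm).enorm
      exact (this.comp (by fun_prop : Measurable fun θ : ℝ => (z.1 + θ • h, z.2)) :)
    calc _ ≤ (∫⁻ θ in Icc (0 : ℝ) 1, ‖h‖ₑ * ‖fieldOf g (consLast (z.1 + θ • h) z.2)‖ₑ) ^ p := by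
          refine ENNReal.rpow_le_rpow ((enorm_integral_le_lintegral_enorm _).trans ?_) hp0.le
          refine lintegral_mono fun θ => ?_
          have hn : ‖consLast h 0‖ₑ = ‖h‖ₑ := by
            rw [← enorm_norm, norm_consLast_zero, enorm_norm]
          rw [← hn]
          exact enorm_sum_mul_le g (consLast h 0) (consLast (z.1 + θ • h) z.2)
      _ ≤ _ := by
          rw [lintegral_const_mul _ hm, ENNReal.mul_rpow_of_nonneg _ _ hp0.le]
          gcongr
          -- Hölder costs nothing here because the parameter interval has length one.
          refine (rpow_lintegral_le hp hm.aemeasurable).trans_eq ?_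
          simp
  have hdiff' : ∀ᵐ t : ℝ, ∀ᵐ x : RSpace d, t ∈ T →
      ‖u (consLast (x + h) t) - u (consLast x t)‖ₑ ^ p ≤
        ‖h‖ₑ ^ p * ∫⁻ θ in Icc (0 : ℝ) 1, ‖fieldOf g (consLast (x + θ • h) t)‖ₑ ^ p := by
    have := (Measure.measurePreserving_swap (μ := (volume : Measure ℝ))
      (ν := (volume : Measure (RSpace d)))).quasiMeasurePreserving.ae hdiff
    exact Measure.ae_ae_of_ae_prod this
  -- Integrating over all $x$ first makes the shift by $\theta h$ invisible, and the average over
  -- $\theta$ drops out.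
  have hthree : ∀ t, ∫⁻ x, ∫⁻ θ in Icc (0 : ℝ) 1, ‖fieldOf g (consLast (x + θ • h) t)‖ₑ ^ p =
      ∫⁻ x, ‖fieldOf g (consLast x t)‖ₑ ^ p := by
    intro t
    rw [lintegral_lintegral_swap]
    · have : ∀ θ : ℝ, ∫⁻ x, ‖fieldOf g (consLast (x + θ • h) t)‖ₑ ^ p =
          ∫⁻ x, ‖fieldOf g (consLast x t)‖ₑ ^ p := fun θ =>
        lintegral_add_right_eq_self (fun x => ‖fieldOf g (consLast x t)‖ₑ ^ p) (θ • h)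
      simp [this]
    · exact (hF3.comp (by fun_prop : Measurable fun y : RSpace d × ℝ =>
        ((t, y.1), y.2)) :).aemeasurable
  rw [← lintegral_const_mul _ hF.lintegral_prod_left']
  refine setLIntegral_mono_ae' hT ?_
  filter_upwards [hdiff'] with t ht htT
  rw [← hthree, ← lintegral_const_mul]
  · refine lintegral_mono_ae ?_
    filter_upwards [ht] with x hx using hx htT
  · exact (hF3.comp (by fun_prop : Measurable fun y : RSpace d × ℝ =>
      ((t, y.1), y.2)) :).lintegral_prod_right'

theorem lintegral_strip {F : RSpace (d + 1) → ℝ≥0∞} (hF : Measurable F) :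
    ∫⁻ y in strip d bm bp, F y = ∫⁻ t in Ioo bm bp, ∫⁻ x, F (consLast x t) := by
  have hpre : (consLastEquiv d) ⁻¹' strip d bm bp = univ ×ˢ Ioo bm bp := by
    ext z; simp
  rw [← measurePreserving_consLast.setLIntegral_comp_preimage (isOpen_strip bm bp).measurableSet hF,
    hpre, ← Measure.prod_restrict, Measure.restrict_univ,
    lintegral_prod_symm _ (by exact (measurable_comp_consLast _ hF).aemeasurable)]
  rfl

/-- The screened seminorm bound for boundary values attained along a measure preserving
parametrization of the vertical variable. -/
theorem exists_screened_bound (hd : 1 ≤ d) {p : ℝ} (hp : 1 < p) : ∃ C : ℝ≥0∞, C ≠ ⊤ ∧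
    ∀ (bm bp : ℝ) (u : RSpace (d + 1) → ℝ) (g : Fin (d + 1) → RSpace (d + 1) → ℝ)
      (f : RSpace d → ℝ) (τ : ℝ ≃ᵐ ℝ), IsSobolevPair p bm bp u g → Measurable f →
      MeasurePreserving τ volume volume → τ ⁻¹' (Ioo bm bp) = Ioo 0 (bp - bm) →
      (∀ᵐ x : RSpace d, ∀ᵐ r ∂volume.restrict (Ioo 0 (bp - bm)),
        ‖u (consLast x (τ r)) - f x‖ₑ ≤ ∫⁻ s in Ioo 0 r, ‖g (Fin.last d) (consLast x (τ s))‖ₑ) →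
      ∫⁻ x : RSpace d, ∫⁻ h in Metric.ball (0 : RSpace d) (bp - bm),
        ‖f (x + h) - f x‖ₑ ^ p / ‖h‖ₑ ^ ((1 - 1 / p) * p + d) ≤
          C * ∫⁻ y in strip d bm bp, ‖fieldOf g y‖ₑ ^ p := by
  obtain ⟨C, hC, hslab⟩ := exists_screened_slab_bound hd hp
  refine ⟨C, hC, fun bm bp u g f τ H hf hτ hpre hvert => ?_⟩
  have hgm := measurable_fieldOf H.measurable_partial
  have hτz : Measurable fun z : RSpace d × ℝ => (z.1, τ z.2) :=
    measurable_fst.prodMk (τ.measurable.comp measurable_snd)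
  have hF : Measurable fun y => ‖fieldOf g y‖ₑ ^ p := hgm.enorm.pow_const p
  have hw : Measurable (Function.uncurry fun x r => u (consLast x (τ r))) :=
    ((measurable_comp_consLast u H.measurable).comp hτz :)
  have hG : Measurable (Function.uncurry fun x r => ‖fieldOf g (consLast x (τ r))‖ₑ) :=
    ((measurable_comp_consLast (fieldOf g) hgm).enorm.comp hτz :)
  -- The norm of the full gradient serves as the majorant, since it must control both the vertical
  -- derivative and the horizontal differences.
  have key := hslab (bp - bm) f (fun x r => u (consLast x (τ r)))
    (fun x r => ‖fieldOf g (consLast x (τ r))‖ₑ) hf hw hG ?_ ?_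
  · refine key.trans_eq ?_
    rw [lintegral_strip hF, ← hpre]
    congr 1
    exact hτ.setLIntegral_comp_preimage measurableSet_Ioo
      (measurable_comp_consLast _ hF).lintegral_prod_left'
  · refine (Measure.ae_ae_comm (p := fun (x : RSpace d) (r : ℝ) => ‖u (consLast x (τ r)) - f x‖ₑ ≤
      ∫⁻ s in Ioo 0 r, ‖fieldOf g (consLast x (τ s))‖ₑ) ?_).1 ?_
    · refine measurableSet_le ?_ ?_
      · exact (hw.sub (hf.comp measurable_fst :)).enorm
      · exact measurable_lintegral_Ioo hG (measurable_const (a := (0 : ℝ)))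
    · filter_upwards [hvert] with x hx
      filter_upwards [hx] with r hr
      exact hr.trans (lintegral_mono fun s => enorm_le_enorm_fieldOf g _ _)
  · intro h r₁ r₂ h1 h2
    have hT : MeasurableSet (τ.symm ⁻¹' Ioo r₁ r₂) := τ.symm.measurable measurableSet_Ioo
    have hTI : τ.symm ⁻¹' Ioo r₁ r₂ ⊆ Ioo bm bp := by
      intro t ht
      have : τ.symm t ∈ Ioo 0 (bp - bm) := Ioo_subset_Ioo h1 h2 ht
      rw [← hpre] at this
      simpa using this
    have := H.lintegral_horizontal_le hp h hT hTI
    rw [← hτ.setLIntegral_comp_preimage hT, ← hτ.setLIntegral_comp_preimage hT] at this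
    · have e : τ ⁻¹' (τ.symm ⁻¹' Ioo r₁ r₂) = Ioo r₁ r₂ := by ext; simp
      rwa [e] at this
    · exact (measurable_comp_consLast _ hF).lintegral_prod_left'
    · refine Measurable.lintegral_prod_left' (f := fun z : RSpace d × ℝ =>
        ‖u (consLast (z.1 + h) z.2) - u (consLast z.1 z.2)‖ₑ ^ p) ?_
      refine (Measurable.enorm (Measurable.sub ?_
        (measurable_comp_consLast u H.measurable))).pow_const p
      exact ((measurable_comp_consLast u H.measurable).comp
        (by fun_prop : Measurable fun z : RSpace d × ℝ => (z.1 + h, z.2)) :)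

end

/-! ### Boundary values and their estimates -/

section


variable {d : ℕ} {p bm bp : ℝ} {u : RSpace (d + 1) → ℝ} {g : Fin (d + 1) → RSpace (d + 1) → ℝ}

theorem lintegral_strip_vertical {F : RSpace (d + 1) → ℝ≥0∞} (hF : Measurable F) :
    ∫⁻ y in strip d bm bp, F y = ∫⁻ x, ∫⁻ t in Ioo bm bp, F (consLast x t) := by
  rw [lintegral_strip hF, lintegral_lintegral_swap]
  exact ((measurable_comp_consLast _ hF).comp measurable_swap :).aemeasurable

theorem measurePreserving_consLast_strip :
    MeasurePreserving (consLastEquiv d) ((volume.prod volume).restrict (univ ×ˢ Ioo bm bp))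
      (volume.restrict (strip d bm bp)) := by
  have hpre : (consLastEquiv d) ⁻¹' strip d bm bp = univ ×ˢ Ioo bm bp := by
    ext z; simp
  rw [← hpre]
  exact measurePreserving_consLast.restrict_preimage (isOpen_strip bm bp).measurableSet

/-- The strip has bounded height, so the cylinder over `K` has finite measure and $L^p\subseteq L^1$
there. Integrability reaches up to the boundary, which is what allows end values to exist. -/
theorem IsSobolevPair.integrableOn_partial_prod (hp : 1 < p) (H : IsSobolevPair p bm bp u g)
    (i : Fin (d + 1)) {K : Set (RSpace d)} (hK : volume K ≠ ⊤) :
    IntegrableOn (fun z : RSpace d × ℝ => g i (consLast z.1 z.2)) (K ×ˢ Ioo bm bp) := by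
  have h1 := (H.memLp_partial i).comp_measurePreserving measurePreserving_consLast_strip
  have h2 : MemLp (fun z : RSpace d × ℝ => g i (consLast z.1 z.2)) (ENNReal.ofReal p)
      (volume.restrict (K ×ˢ Ioo bm bp)) :=
    h1.mono_measure (Measure.restrict_mono (prod_mono_left (subset_univ _)) le_rfl)
  have : IsFiniteMeasure ((volume : Measure (RSpace d × ℝ)).restrict (K ×ˢ Ioo bm bp)) := by
    refine ⟨?_⟩
    rw [Measure.restrict_apply_univ, Measure.volume_eq_prod, Measure.prod_prod]
    exact ENNReal.mul_lt_top hK.lt_top measure_Ioo_lt_top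
  exact h2.integrable (by simpa using hp.le)

theorem IsSobolevPair.ae_integrableOn_partial (hp : 1 < p) (H : IsSobolevPair p bm bp u g)
    (i : Fin (d + 1)) :
    ∀ᵐ x : RSpace d, IntegrableOn (fun t => g i (consLast x t)) (Ioo bm bp) := by
  have : ∀ n : ℕ, ∀ᵐ x : RSpace d, x ∈ Metric.ball (0 : RSpace d) n →
      IntegrableOn (fun t => g i (consLast x t)) (Ioo bm bp) := by
    intro n
    have h := H.integrableOn_partial_prod hp i
      (measure_ball_lt_top (μ := volume) (x := (0 : RSpace d)) (r := n)).ne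
    rw [IntegrableOn, Measure.volume_eq_prod, ← Measure.prod_restrict] at h
    exact (ae_restrict_iff' measurableSet_ball).1 h.prod_right_ae
  filter_upwards [ae_all_iff.2 this] with x hx
  obtain ⟨n, hn⟩ := exists_nat_gt ‖x‖
  exact hx n (by simpa using hn)

/-- `fm` and `fp` are the boundary values at the bottom and the top of a function on the strip whose
vertical derivative is `g`. -/
structure IsTracePair (bm bp : ℝ) (u g : RSpace (d + 1) → ℝ) (fm fp : RSpace d → ℝ) : Prop where
  measurable_bot : Measurable fm
  measurable_top : Measurable fp
  integrableOn : ∀ᵐ x : RSpace d, IntegrableOn (fun t => g (consLast x t)) (Ioo bm bp)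
  eq_top : ∀ x, fp x = fm x + ∫ s in bm..bp, g (consLast x s)
  primitive : ∀ᵐ x : RSpace d, ∀ᵐ t ∂volume.restrict (Ioo bm bp),
    u (consLast x t) = fm x + ∫ s in bm..t, g (consLast x s)

theorem IsSobolevPair.exists_tracePair (hp : 1 < p) (hab : bm < bp)
    (H : IsSobolevPair p bm bp u g) :
    ∃ fm fp : RSpace d → ℝ, IsTracePair bm bp u (g (Fin.last d)) fm fp := by
  have hgm := measurable_comp_consLast _ (H.measurable_partial (Fin.last d))
  have hgi := H.ae_integrableOn_partial hp (Fin.last d)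
  have hdiff : ∀ τ : ℝ, ∀ᵐ z : RSpace d × ℝ, z.2 ∈ Ioo bm bp → z.2 + τ ∈ Ioo bm bp →
      u (consLast z.1 (z.2 + τ)) - u (consLast z.1 z.2) =
        ∫ s in z.2..z.2 + τ, g (Fin.last d) (consLast z.1 s) := by
    intro τ
    have := measurePreserving_consLast.quasiMeasurePreserving.ae
      (ae_strip_sub_eq_integral H.isLocLp H.isWeakPartial (consLast 0 τ))
    rw [← Measure.volume_eq_prod] at this
    filter_upwards [this] with z hz h1 h2
    have e : ∀ θ : ℝ, consLast z.1 z.2 + θ • consLast 0 τ = consLast z.1 (z.2 + τ * θ) := by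
      intro θ
      rw [← consLast_smul, ← consLast_add, smul_zero, add_zero, mul_comm]
    have e1 := e 1
    rw [one_smul, mul_one] at e1
    simp only [consLastEquiv_apply, e, e1, consLast_mem_strip] at hz
    rw [hz h1 h2, integral_Icc_eq_integral_Ioc, ← intervalIntegral.integral_of_le zero_le_one]
    -- Only the vertical component of the shift is nonzero. The substitution $s = t+\tau\theta$ then
    -- turns the integral over the unit segment into an oriented interval integral, for either sign
    -- of $\tau$.
    simp only [Fin.sum_univ_castSucc, consLast_castSucc, consLast_last, PiLp.zero_apply, zero_mul,
      Finset.sum_const_zero, zero_add]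
    rw [intervalIntegral.integral_const_mul]
    simpa using intervalIntegral.mul_integral_comp_add_mul (a := 0) (b := 1)
      (f := fun s => g (Fin.last d) (consLast z.1 s)) τ z.2
  obtain ⟨f, hf, hrep⟩ := exists_vertical_primitive hab
    (u := fun x t => u (consLast x t)) (g := fun x t => g (Fin.last d) (consLast x t))
    (measurable_comp_consLast u H.measurable) hgm hgi hdiff
  refine ⟨f, fun x => f x + ∫ s in bm..bp, g (Fin.last d) (consLast x s), hf, hf.add ?_, hgi,
    fun x => rfl, hrep⟩
  simp_rw [intervalIntegral.integral_of_le hab.le]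
  exact (hgm.stronglyMeasurable.integral_prod_right'
      (ν := volume.restrict (Ioc bm bp))).measurable

theorem isCompact_image_consLast {K : Set (RSpace d)} (hK : IsCompact K) (s t : ℝ) :
    IsCompact ((fun z : RSpace d × ℝ => consLast z.1 z.2) '' (K ×ˢ Icc s t)) :=
  (hK.prod isCompact_Icc).image continuous_consLast

theorem IsSobolevPair.integrableOn_prod (H : IsSobolevPair p bm bp u g) {K : Set (RSpace d)}
    (hK : IsCompact K) {s t : ℝ} (hs : bm < s) (ht : t < bp) :
    IntegrableOn (fun z : RSpace d × ℝ => u (consLast z.1 z.2)) (K ×ˢ Icc s t) := by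
  have h1 := H.isLocLp.integrableOn (isCompact_image_consLast hK s t) (by
    rintro _ ⟨z, hz, rfl⟩
    exact consLast_mem_strip.2 ⟨hs.trans_le hz.2.1, hz.2.2.trans_lt ht⟩)
  have h2 := (measurePreserving_consLast.integrableOn_comp_preimage
    (consLastEquiv d).measurableEmbedding).2 h1
  refine IntegrableOn.mono_set h2 fun z hz => ⟨z, hz, rfl⟩

theorem IsTracePair.integrableOn_bot (hp : 1 < p) (hab : bm < bp) (H : IsSobolevPair p bm bp u g)
    {fm fp : RSpace d → ℝ} (T : IsTracePair bm bp u (g (Fin.last d)) fm fp) {K : Set (RSpace d)}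
    (hK : IsCompact K) : IntegrableOn fm K := by
  obtain ⟨s, hs1, hs2⟩ := exists_between hab
  obtain ⟨t, ht1, ht2⟩ := exists_between hs2
  exact integrableOn_of_vertical_primitive ht1 hs1 ht2 T.measurable_bot
    (u := fun x t => u (consLast x t)) (g := fun x t => g (Fin.last d) (consLast x t))
    (H.integrableOn_prod hK hs1 ht2) (H.integrableOn_partial_prod hp _ hK.measure_lt_top.ne)
    T.primitive

theorem IsTracePair.integrableOn_top (hp : 1 < p) (hab : bm < bp) (H : IsSobolevPair p bm bp u g)
    {fm fp : RSpace d → ℝ} (T : IsTracePair bm bp u (g (Fin.last d)) fm fp) {K : Set (RSpace d)}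
    (hK : IsCompact K) : IntegrableOn fp K := by
  have h := H.integrableOn_partial_prod hp (Fin.last d) hK.measure_lt_top.ne
  rw [IntegrableOn, Measure.volume_eq_prod, ← Measure.prod_restrict] at h
  refine ((T.integrableOn_bot hp hab H hK).add h.integral_prod_left).congr
    (Filter.Eventually.of_forall fun x => ?_)
  simp only [Pi.add_apply]
  rw [T.eq_top, intervalIntegral.integral_of_le hab.le, integral_Ioc_eq_integral_Ioo]

/-- Hölder's inequality on each vertical segment; the factor is the $(p-1)$-th power of the
segment's length, with no further constant. -/
theorem IsTracePair.lintegral_sub_le (hp : 1 < p) (hab : bm < bp) (H : IsSobolevPair p bm bp u g)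
    {fm fp : RSpace d → ℝ} (T : IsTracePair bm bp u (g (Fin.last d)) fm fp) :
    ∫⁻ x, ‖fp x - fm x‖ₑ ^ p ≤ ENNReal.ofReal ((bp - bm) ^ (p - 1)) *
      ∫⁻ y in strip d bm bp, ‖g (Fin.last d) y‖ₑ ^ p := by
  have hp0 : 0 < p := by linarith
  have hgm := measurable_comp_consLast _ (H.measurable_partial (Fin.last d))
  rw [lintegral_strip_vertical ((H.measurable_partial _).enorm.pow_const p),
    ← lintegral_const_mul]
  · refine lintegral_mono fun x => ?_
    have e : fp x - fm x = ∫ s in Ioo bm bp, g (Fin.last d) (consLast x s) := by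
      rw [T.eq_top, add_sub_cancel_left, intervalIntegral.integral_of_le hab.le,
        integral_Ioc_eq_integral_Ioo]
    calc ‖fp x - fm x‖ₑ ^ p ≤ (∫⁻ s in Ioo bm bp, ‖g (Fin.last d) (consLast x s)‖ₑ) ^ p := by
          rw [e]
          exact ENNReal.rpow_le_rpow (enorm_integral_le_lintegral_enorm _) hp0.le
      _ ≤ _ := rpow_lintegral_le hp (hgm.comp measurable_prodMk_left :).enorm.aemeasurable
      _ = _ := by
          rw [Measure.restrict_apply_univ, Real.volume_Ioo,
            ENNReal.ofReal_rpow_of_pos (sub_pos.2 hab)]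
  · exact (hgm.enorm.pow_const p).lintegral_prod_right'

theorem enorm_intervalIntegral_le {g : ℝ → ℝ} {a b : ℝ} (hab : a ≤ b) :
    ‖∫ s in a..b, g s‖ₑ ≤ ∫⁻ s in Ioo a b, ‖g s‖ₑ := by
  rw [intervalIntegral.integral_of_le hab, integral_Ioc_eq_integral_Ioo]
  exact enorm_integral_le_lintegral_enorm _

/-- Both planes reduce to the same half-slab estimate when height is measured as distance from the
plane: $r\mapsto b^-+r$ at the bottom, and the reflection $r\mapsto b^+-r$ at the top. -/
theorem exists_screened_trace_bound (hd : 1 ≤ d) {p : ℝ} (hp : 1 < p) : ∃ C : ℝ≥0∞, C ≠ ⊤ ∧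
    ∀ (bm bp : ℝ) (u : RSpace (d + 1) → ℝ) (g : Fin (d + 1) → RSpace (d + 1) → ℝ)
      (fm fp : RSpace d → ℝ), bm < bp → IsSobolevPair p bm bp u g →
      IsTracePair bm bp u (g (Fin.last d)) fm fp → ∀ f, f = fm ∨ f = fp →
      ∫⁻ x : RSpace d, ∫⁻ h in Metric.ball (0 : RSpace d) (bp - bm),
        ‖f (x + h) - f x‖ₑ ^ p / ‖h‖ₑ ^ ((1 - 1 / p) * p + d) ≤
          C * ∫⁻ y in strip d bm bp, ‖fieldOf g y‖ₑ ^ p := by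
  obtain ⟨C, hC, hb⟩ := exists_screened_bound hd hp
  refine ⟨C, hC, fun bm bp u g fm fp hab H T f hf => ?_⟩
  rcases hf with rfl | rfl
  · have hpre : (MeasurableEquiv.addLeft bm) ⁻¹' (Ioo bm bp) = Ioo 0 (bp - bm) := by
      ext r; simp [lt_sub_iff_add_lt']
    have hmp : MeasurePreserving (MeasurableEquiv.addLeft bm) (volume : Measure ℝ) volume :=
      measurePreserving_add_left volume bm
    refine hb bm bp u g f (MeasurableEquiv.addLeft bm) H T.measurable_bot hmp hpre ?_
    filter_upwards [T.primitive] with x hx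
    rw [← hpre]
    filter_upwards [(hmp.restrict_preimage measurableSet_Ioo).quasiMeasurePreserving.ae hx,
      ae_restrict_mem ((MeasurableEquiv.addLeft bm).measurable measurableSet_Ioo)] with r hr hrm
    rw [hpre] at hrm
    have e : (fun s => bm + s) ⁻¹' Ioo bm (bm + r) = Ioo 0 r := by ext s; simp
    rw [hr, add_sub_cancel_left]
    refine (enorm_intervalIntegral_le (by simpa using hrm.1.le)).trans_eq ?_
    have := hmp.setLIntegral_comp_preimage_emb (MeasurableEquiv.addLeft bm).measurableEmbedding
      (fun s => ‖g (Fin.last d) (consLast x s)‖ₑ) (Ioo bm (bm + r))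
    rw [← e]
    exact this.symm
  · have hpre : (MeasurableEquiv.subLeft bp) ⁻¹' (Ioo bm bp) = Ioo 0 (bp - bm) := by
      ext r
      change bp - r ∈ Ioo bm bp ↔ r ∈ Ioo 0 (bp - bm)
      simp only [mem_Ioo]
      constructor <;> rintro ⟨h1, h2⟩ <;> constructor <;> linarith
    have hmp : MeasurePreserving (MeasurableEquiv.subLeft bp) (volume : Measure ℝ) volume :=
      Measure.measurePreserving_sub_left volume bp
    refine hb bm bp u g f (MeasurableEquiv.subLeft bp) H T.measurable_top hmp hpre ?_
    filter_upwards [T.primitive, T.integrableOn] with x hx hxi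
    rw [← hpre]
    filter_upwards [(hmp.restrict_preimage measurableSet_Ioo).quasiMeasurePreserving.ae hx,
      ae_restrict_mem ((MeasurableEquiv.subLeft bp).measurable measurableSet_Ioo)] with r hr hrm
    have hrI : bp - r ∈ Ioo bm bp := hrm
    rw [hpre] at hrm
    have e : (fun s => bp - s) ⁻¹' Ioo (bp - r) bp = Ioo 0 r := by
      ext s
      simp only [mem_preimage, mem_Ioo]
      constructor <;> rintro ⟨h1, h2⟩ <;> constructor <;> linarith
    have e2 := intervalIntegral.integral_interval_sub_left
      (intervalIntegrable_of_mem_Icc hxi (left_mem_Icc.2 hab.le) (right_mem_Icc.2 hab.le))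
      (intervalIntegrable_of_mem_Icc hxi (left_mem_Icc.2 hab.le) (Ioo_subset_Icc_self hrI))
    have e4 : (MeasurableEquiv.subLeft bp) r = bp - r := rfl
    have e3 : u (consLast x (bp - r)) - f x =
        -∫ s in (bp - r)..bp, g (Fin.last d) (consLast x s) := by
      have hr' : u (consLast x (bp - r)) = _ := hr
      rw [hr', e4, T.eq_top, ← e2]
      ring
    rw [e4, e3, enorm_neg]
    refine (enorm_intervalIntegral_le (by linarith [hrm.1])).trans_eq ?_
    have := hmp.setLIntegral_comp_preimage_emb (MeasurableEquiv.subLeft bp).measurableEmbedding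
      (fun s => ‖g (Fin.last d) (consLast x s)‖ₑ) (Ioo (bp - r) bp)
    rw [← e]
    exact this.symm

/-- A locally integrable function of finite screened seminorm is locally in `L^p`. -/
theorem memLp_of_screened {p : ℝ} (hp : 1 < p) {a : ℝ} (ha : 0 < a) {f : RSpace d → ℝ}
    (hf : Measurable f) (hfi : ∀ K, IsCompact K → IntegrableOn f K)
    (hs : ∫⁻ x : RSpace d, ∫⁻ h in Metric.ball (0 : RSpace d) a,
        ‖f (x + h) - f x‖ₑ ^ p / ‖h‖ₑ ^ ((1 - 1 / p) * p + d) ≠ ⊤) {K : Set (RSpace d)}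
    (hK : IsCompact K) : MemLp f (ENNReal.ofReal p) (volume.restrict K) := by
  have hp0 : 0 < p := by linarith
  set q : ℝ := (1 - 1 / p) * p + d with hq
  have hq0 : 0 ≤ q := by
    have : (1 - 1 / p) * p = p - 1 := by field_simp
    rw [hq, this]
    have : (0 : ℝ) ≤ d := Nat.cast_nonneg d
    linarith
  set B := Metric.ball (0 : RSpace d) a
  set m := volume B with hm
  have hm0 : m ≠ 0 := (Metric.measure_ball_pos volume _ ha).ne'
  have hmtop : m ≠ ⊤ := measure_ball_lt_top.ne
  set K' := Metric.cthickening a K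
  have hK' : IsCompact K' := hK.cthickening
  set M := ∫⁻ y in K', ‖f y‖ₑ with hM
  have hMtop : M ≠ ⊤ := (hfi K' hK').2.ne
  set S : RSpace d → ℝ≥0∞ := fun x => ∫⁻ h in B, ‖f (x + h) - f x‖ₑ ^ p / ‖h‖ₑ ^ q with hS
  have haq : ENNReal.ofReal a ^ q ≠ ⊤ := ENNReal.rpow_ne_top_of_nonneg hq0 ENNReal.ofReal_ne_top
  -- $|f(x)|\le|f(x+h)|+|f(x+h)-f(x)|$ is integrated over the ball. The first term is at most the
  -- $L^1$ norm on a compact thickening of $K$. The second is handled by Hölder, using that the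
  -- weight $|h|^{-q}$ is at least $a^{-q}$ on the ball.
  have hpt : ∀ x ∈ K, (m * ‖f x‖ₑ) ^ p ≤
      2 ^ (p - 1) * (M ^ p + m ^ (p - 1) * (ENNReal.ofReal a ^ q * S x)) := by
    intro x hx
    have hsh : ∫⁻ h in B, ‖f (x + h)‖ₑ ≤ M := by
      have e : (fun h => x + h) ⁻¹' ((fun h => x + h) '' B) = B :=
        preimage_image_eq _ (add_right_injective x)
      have h1 := (measurePreserving_add_left (volume : Measure (RSpace d))
        x).setLIntegral_comp_preimage_emb (MeasurableEquiv.addLeft x).measurableEmbedding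
        (fun y => ‖f y‖ₑ) ((fun h => x + h) '' B)
      rw [e] at h1
      rw [h1]
      refine lintegral_mono_set ?_
      rintro _ ⟨h, hh, rfl⟩
      refine Metric.mem_cthickening_of_dist_le _ x _ _ hx ?_
      have : ‖h‖ < a := by simpa [B] using hh
      simpa using this.le
    have hD : ∫⁻ h in B, ‖f (x + h) - f x‖ₑ ^ p ≤ ENNReal.ofReal a ^ q * S x := by
      rw [hS, ← lintegral_const_mul _ (by fun_prop)]
      refine setLIntegral_mono' measurableSet_ball fun h hh => ?_
      have hha : ‖h‖ₑ ≤ ENNReal.ofReal a := by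
        rw [← ofReal_norm]
        exact ENNReal.ofReal_le_ofReal (by simpa [B] using (mem_ball_zero_iff.1 hh).le)
      -- At $h=0$ the weight cannot be cancelled, but the difference itself vanishes.
      rcases eq_or_ne h 0 with rfl | h0
      · simp [hp0]
      · have hne : ‖h‖ₑ ^ q ≠ 0 := by simp [ENNReal.rpow_eq_zero_iff, h0]
        have hnt : ‖h‖ₑ ^ q ≠ ⊤ := ENNReal.rpow_ne_top_of_nonneg hq0 enorm_ne_top
        calc ‖f (x + h) - f x‖ₑ ^ p = ‖h‖ₑ ^ q * (‖f (x + h) - f x‖ₑ ^ p / ‖h‖ₑ ^ q) :=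
              (ENNReal.mul_div_cancel hne hnt).symm
          _ ≤ _ := by gcongr
    calc (m * ‖f x‖ₑ) ^ p ≤ (M + ∫⁻ h in B, ‖f (x + h) - f x‖ₑ) ^ p := by
          refine ENNReal.rpow_le_rpow ?_ hp0.le
          calc m * ‖f x‖ₑ = ∫⁻ _ in B, ‖f x‖ₑ := by rw [setLIntegral_const, mul_comm]
            _ ≤ ∫⁻ h in B, (‖f (x + h)‖ₑ + ‖f (x + h) - f x‖ₑ) := by
                refine lintegral_mono fun h => ?_
                calc ‖f x‖ₑ = ‖f (x + h) - (f (x + h) - f x)‖ₑ := by simp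
                  _ ≤ _ := enorm_sub_le
            _ = (∫⁻ h in B, ‖f (x + h)‖ₑ) + ∫⁻ h in B, ‖f (x + h) - f x‖ₑ :=
                lintegral_add_left (by fun_prop) _
            _ ≤ _ := by gcongr
      _ ≤ 2 ^ (p - 1) * (M ^ p + (∫⁻ h in B, ‖f (x + h) - f x‖ₑ) ^ p) :=
          ENNReal.rpow_add_le_mul_rpow_add_rpow _ _ hp.le
      _ ≤ _ := by
          gcongr
          refine (rpow_lintegral_le hp (by fun_prop)).trans ?_
          rw [Measure.restrict_apply_univ]
          gcongr
  have hSm : Measurable S := by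
    refine Measurable.lintegral_prod_right' (f := fun z : RSpace d × RSpace d =>
      ‖f (z.1 + z.2) - f z.1‖ₑ ^ p / ‖z.2‖ₑ ^ q) ?_
    fun_prop
  have hint : ∫⁻ x in K, (m * ‖f x‖ₑ) ^ p ≠ ⊤ := by
    refine ne_top_of_le_ne_top ?_ (setLIntegral_mono' hK.measurableSet hpt)
    rw [lintegral_const_mul _ (by fun_prop), lintegral_add_left measurable_const,
      lintegral_const_mul _ (by fun_prop), lintegral_const_mul _ hSm, setLIntegral_const]
    have h2 : (2 : ℝ≥0∞) ^ (p - 1) ≠ ⊤ := ENNReal.rpow_ne_top_of_nonneg (by linarith) (by norm_num)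
    refine ENNReal.mul_ne_top h2 (ENNReal.add_ne_top.2 ⟨?_, ?_⟩)
    · exact ENNReal.mul_ne_top (ENNReal.rpow_ne_top_of_nonneg hp0.le hMtop)
        hK.measure_lt_top.ne
    · refine ENNReal.mul_ne_top (ENNReal.rpow_ne_top_of_nonneg (by linarith) hmtop)
        (ENNReal.mul_ne_top haq (ne_top_of_le_ne_top hs ?_))
      exact lintegral_mono' Measure.restrict_le_self le_rfl
  refine ⟨hf.aestronglyMeasurable, ?_⟩
  rw [eLpNorm_lt_top_iff_lintegral_rpow_enorm_lt_top (by simpa using hp0) ENNReal.ofReal_ne_top,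
    ENNReal.toReal_ofReal hp0.le]
  simp_rw [ENNReal.mul_rpow_of_nonneg _ _ hp0.le] at hint
  rw [lintegral_const_mul _ (by fun_prop)] at hint
  refine lt_top_iff_ne_top.2 fun h => hint ?_
  rw [h, ENNReal.mul_top]
  simp [ENNReal.rpow_eq_zero_iff, hm0, hp0.not_gt]

end

/-! ### Integration by parts -/

section


variable {d : ℕ} {p bm bp : ℝ} {u : RSpace (d + 1) → ℝ} {g : Fin (d + 1) → RSpace (d + 1) → ℝ}

/-- Integration by parts of a primitive against a continuously differentiable function. -/
theorem integral_primitive_mul_deriv {a b : ℝ} {g η : ℝ → ℝ} (hg : IntervalIntegrable g volume a b)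
    (hη : ContDiff ℝ 1 η) (c : ℝ) :
    ∫ t in a..b, (c + ∫ s in a..t, g s) * deriv η t =
      (c + ∫ s in a..b, g s) * η b - c * η a - ∫ t in a..b, g t * η t := by
  -- $g$ is merely integrable, so its primitive is only absolutely continuous, with derivative $g$
  -- almost everywhere.
  have h1 : AbsolutelyContinuousOnInterval (fun t => c + ∫ s in a..t, g s) a b :=
    (contDiff_const.contDiffOn.absolutelyContinuousOnInterval).add
      (hg.absolutelyContinuousOnInterval_intervalIntegral left_mem_uIcc)
  have h2 : AbsolutelyContinuousOnInterval η a b := hη.contDiffOn.absolutelyContinuousOnInterval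
  rw [h1.integral_mul_deriv_eq_deriv_mul h2, intervalIntegral.integral_same, add_zero]
  congr 1
  refine intervalIntegral.integral_congr_ae ?_
  filter_upwards [hg.ae_hasDerivAt_integral] with t ht htm
  have := ((ht (uIoc_subset_uIcc htm) a left_mem_uIcc).const_add c).deriv
  rw [this]

theorem isCompact_image_horiz {B : Set (RSpace (d + 1))} (hB : IsCompact B) :
    IsCompact (horiz '' B) := hB.image continuous_horiz

/-- Integrability on bounded parts of the strip, up to the boundary. -/
theorem integrableOn_strip_inter {F : RSpace (d + 1) → ℝ}
    (hF : ∀ K : Set (RSpace d), IsCompact K →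
      IntegrableOn (fun z : RSpace d × ℝ => F (consLast z.1 z.2)) (K ×ˢ Ioo bm bp))
    {B : Set (RSpace (d + 1))} (hB : IsCompact B) : IntegrableOn F (strip d bm bp ∩ B) := by
  refine (measurePreserving_consLast.integrableOn_comp_preimage
    (consLastEquiv d).measurableEmbedding).1 ?_
  refine IntegrableOn.mono_set (hF _ (isCompact_image_horiz hB)) ?_
  rintro z ⟨h1, h2⟩
  exact ⟨⟨_, h2, by simp⟩, consLast_mem_strip.1 h1⟩

theorem integrableOn_strip_mul {F θ : RSpace (d + 1) → ℝ}
    (hF : ∀ B, IsCompact B → IntegrableOn F (strip d bm bp ∩ B)) (hθ : Continuous θ)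
    (hc : HasCompactSupport θ) : IntegrableOn (fun y => F y * θ y) (strip d bm bp) := by
  obtain ⟨C, hC⟩ := hc.exists_bound_of_continuous hθ
  have h1 : IntegrableOn (fun y => F y * θ y) (strip d bm bp ∩ tsupport θ) :=
    (hF _ hc).mul_bdd (c := C) hθ.aestronglyMeasurable (Filter.Eventually.of_forall hC)
  refine h1.of_forall_sdiff_eq_zero (isOpen_strip bm bp).measurableSet fun y hy => ?_
  have : y ∉ tsupport θ := fun h => hy.2 ⟨hy.1, h⟩
  rw [image_eq_zero_of_notMem_tsupport this, mul_zero]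

theorem setIntegral_strip {F : RSpace (d + 1) → ℝ} (hF : IntegrableOn F (strip d bm bp)) :
    ∫ y in strip d bm bp, F y = ∫ x, ∫ t in Ioo bm bp, F (consLast x t) := by
  have h1 := measurePreserving_consLast_strip (d := d) (bm := bm) (bp := bp)
  rw [← h1.integral_comp (consLastEquiv d).measurableEmbedding, ← Measure.prod_restrict,
    Measure.restrict_univ, integral_prod]
  · rfl
  · have h2 := h1.integrable_comp_of_integrable hF
    rwa [← Measure.prod_restrict, Measure.restrict_univ] at h2

theorem integrable_strip_inner {F : RSpace (d + 1) → ℝ} (hF : IntegrableOn F (strip d bm bp)) :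
    Integrable fun x => ∫ t in Ioo bm bp, F (consLast x t) := by
  have h2 := (measurePreserving_consLast_strip (d := d) (bm := bm)
    (bp := bp)).integrable_comp_of_integrable hF
  rw [← Measure.prod_restrict, Measure.restrict_univ] at h2
  exact h2.integral_prod_left

theorem IsSobolevPair.integrableOn_partial_strip (hp : 1 < p) (H : IsSobolevPair p bm bp u g)
    (i : Fin (d + 1)) {B : Set (RSpace (d + 1))} (hB : IsCompact B) :
    IntegrableOn (g i) (strip d bm bp ∩ B) :=
  integrableOn_strip_inter
    (fun _ hK => H.integrableOn_partial_prod hp i hK.measure_lt_top.ne) hB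

/-- The representation gives $|u(x,t)|\le|f^-(x)|+\int|\partial_N u(x,s)|\,ds$, a bound independent
of $t$ and integrable over compact sets of $x$. This upgrades interior local integrability to
integrability up to the boundary. -/
theorem IsTracePair.integrableOn_strip (hp : 1 < p) (hab : bm < bp) (H : IsSobolevPair p bm bp u g)
    {fm fp : RSpace d → ℝ} (T : IsTracePair bm bp u (g (Fin.last d)) fm fp)
    {B : Set (RSpace (d + 1))} (hB : IsCompact B) : IntegrableOn u (strip d bm bp ∩ B) := by
  refine integrableOn_strip_inter (fun K hK => ?_) hB
  have hg := H.integrableOn_partial_prod hp (Fin.last d) hK.measure_lt_top.ne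
  have hgm := measurable_comp_consLast _ (H.measurable_partial (Fin.last d))
  have hum := measurable_comp_consLast u H.measurable
  rw [IntegrableOn, Measure.volume_eq_prod, ← Measure.prod_restrict] at hg ⊢
  set A : RSpace d → ℝ := fun x => ∫ s in Ioo bm bp, ‖g (Fin.last d) (consLast x s)‖ with hA
  have hAi : Integrable A (volume.restrict K) := hg.integral_norm_prod_left
  have hAm : Measurable A :=
    (hgm.norm.stronglyMeasurable.integral_prod_right' (ν := volume.restrict (Ioo bm bp))).measurable
  have hdom : Integrable (fun z : RSpace d × ℝ => ‖fm z.1‖ + A z.1)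
      ((volume.restrict K).prod (volume.restrict (Ioo bm bp))) :=
    ((T.integrableOn_bot hp hab H hK).norm.add hAi).comp_fst _
  refine hdom.mono' hum.aestronglyMeasurable ?_
  refine (Measure.ae_prod_iff_ae_ae ?_).2 ?_
  · exact measurableSet_le hum.norm
      ((T.measurable_bot.norm.add hAm).comp measurable_fst)
  · filter_upwards [ae_restrict_of_ae T.primitive, ae_restrict_of_ae T.integrableOn] with x hx hxi
    filter_upwards [hx, ae_restrict_mem measurableSet_Ioo] with t ht htI
    rw [ht]
    refine (norm_add_le _ _).trans (add_le_add le_rfl ?_)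
    rw [intervalIntegral.integral_of_le htI.1.le]
    refine (norm_integral_le_integral_norm _).trans ?_
    exact setIntegral_mono_set hxi.norm (Filter.Eventually.of_forall fun _ => norm_nonneg _)
      (LE.le.eventuallyLE (show Ioc bm t ⊆ Ioo bm bp from
        fun s hs => ⟨hs.1, hs.2.trans_lt htI.2⟩))

theorem continuous_classicalPartial_of_one {n : ℕ} {ψ : RSpace n → ℝ} (hψ : ContDiff ℝ 1 ψ)
    (i : Fin n) : Continuous (classicalPartial i ψ) :=
  (hψ.continuous_fderiv (by simp)).clm_apply continuous_const

theorem hasDerivAt_comp_consLast {ψ : RSpace (d + 1) → ℝ} (hψ : ContDiff ℝ 1 ψ) (x : RSpace d)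
    (t : ℝ) : HasDerivAt (fun t => ψ (consLast x t))
      (classicalPartial (Fin.last d) ψ (consLast x t)) t := by
  have e : ∀ t : ℝ, consLast x t = consLast x 0 + t • EuclideanSpace.single (Fin.last d) 1 := by
    intro t
    rw [← consLast_zero, ← consLast_add]
    simp
  have h1 : HasDerivAt (fun t : ℝ => consLast x t) (EuclideanSpace.single (Fin.last d) 1) t := by
    rw [show (fun t : ℝ => consLast x t) = _ from funext e]
    simpa using ((hasDerivAt_id t).smul_const (EuclideanSpace.single (Fin.last d) (1 : ℝ))).const_add
      (consLast x 0)
  exact ((hψ.differentiable (by simp)) (consLast x t)).hasFDerivAt.comp_hasDerivAt t h1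

theorem contDiff_comp_consLast {ψ : RSpace (d + 1) → ℝ} (hψ : ContDiff ℝ 1 ψ) (x : RSpace d) :
    ContDiff ℝ 1 fun t => ψ (consLast x t) := by
  rw [contDiff_one_iff_deriv]
  refine ⟨fun t => (hasDerivAt_comp_consLast hψ x t).differentiableAt, ?_⟩
  have : deriv (fun t => ψ (consLast x t)) =
      fun t => classicalPartial (Fin.last d) ψ (consLast x t) :=
    funext fun t => (hasDerivAt_comp_consLast hψ x t).deriv
  rw [this]
  exact (continuous_classicalPartial_of_one hψ _).comp
    (continuous_consLast.comp (Continuous.prodMk_right x))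

theorem integrable_mul_slice {f : RSpace d → ℝ} (hf : ∀ K, IsCompact K → IntegrableOn f K)
    {ψ : RSpace (d + 1) → ℝ} (hψ : Continuous ψ) (hc : HasCompactSupport ψ) (b : ℝ) :
    Integrable fun x => ψ (consLast x b) * f x := by
  obtain ⟨C, hC⟩ := hc.exists_bound_of_continuous hψ
  have hcont : Continuous fun x : RSpace d => ψ (consLast x b) :=
    hψ.comp (isometry_consLast b).continuous
  have h1 : IntegrableOn (fun x => ψ (consLast x b) * f x) (horiz '' tsupport ψ) :=
    (hf _ (isCompact_image_horiz hc)).bdd_mul (c := C) hcont.aestronglyMeasurable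
      (Filter.Eventually.of_forall fun x => hC _)
  rw [← integrableOn_univ]
  refine h1.of_forall_sdiff_eq_zero MeasurableSet.univ fun x hx => ?_
  have : consLast x b ∉ tsupport ψ := fun h => hx.2 ⟨_, h, by simp⟩
  rw [image_eq_zero_of_notMem_tsupport this, zero_mul]

/-- Integration by parts in the vertical direction. -/
theorem IsTracePair.integral_vertical (hp : 1 < p) (hab : bm < bp) (H : IsSobolevPair p bm bp u g)
    {fm fp : RSpace d → ℝ} (T : IsTracePair bm bp u (g (Fin.last d)) fm fp)
    {ψ : RSpace (d + 1) → ℝ} (hψ : ContDiff ℝ 1 ψ) (hc : HasCompactSupport ψ) :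
    ∫ y in strip d bm bp, u y * classicalPartial (Fin.last d) ψ y =
      -(∫ y in strip d bm bp, ψ y * g (Fin.last d) y) +
        ((∫ x, ψ (consLast x bp) * fp x) - ∫ x, ψ (consLast x bm) * fm x) := by
  have hI1 : IntegrableOn (fun y => u y * classicalPartial (Fin.last d) ψ y) (strip d bm bp) :=
    integrableOn_strip_mul (fun B hB => T.integrableOn_strip hp hab H hB)
      (continuous_classicalPartial_of_one hψ _) (hasCompactSupport_classicalPartial hc _)
  have hI2 : IntegrableOn (fun y => g (Fin.last d) y * ψ y) (strip d bm bp) :=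
    integrableOn_strip_mul (fun B hB => H.integrableOn_partial_strip hp _ hB) hψ.continuous hc
  have hI3 := integrable_mul_slice (fun K hK => T.integrableOn_top hp hab H hK) hψ.continuous hc bp
  have hI4 := integrable_mul_slice (fun K hK => T.integrableOn_bot hp hab H hK) hψ.continuous hc bm
  have hI5 : Integrable fun x => -∫ t in Ioo bm bp,
      g (Fin.last d) (consLast x t) * ψ (consLast x t) := (integrable_strip_inner hI2).neg
  have hI6 : Integrable fun x => ψ (consLast x bp) * fp x - ψ (consLast x bm) * fm x := hI3.sub hI4
  simp_rw [mul_comm (ψ _) (g _ _)]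
  rw [setIntegral_strip hI1, setIntegral_strip hI2, ← integral_neg, ← integral_sub hI3 hI4,
    ← integral_add hI5 hI6]
  refine integral_congr_ae ?_
  filter_upwards [T.primitive, T.integrableOn] with x hx hxi
  have hint := intervalIntegrable_of_mem_Icc hxi (left_mem_Icc.2 hab.le) (right_mem_Icc.2 hab.le)
  have key := integral_primitive_mul_deriv hint (contDiff_comp_consLast hψ x) (fm x)
  rw [← T.eq_top, intervalIntegral.integral_of_le hab.le, intervalIntegral.integral_of_le hab.le,
    integral_Ioc_eq_integral_Ioo, integral_Ioc_eq_integral_Ioo] at key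
  have e : ∫ t in Ioo bm bp, u (consLast x t) * classicalPartial (Fin.last d) ψ (consLast x t) =
      ∫ t in Ioo bm bp, (fm x + ∫ s in bm..t, g (Fin.last d) (consLast x s)) *
        deriv (fun t => ψ (consLast x t)) t := by
    refine integral_congr_ae ?_
    filter_upwards [hx] with t ht
    rw [ht, (hasDerivAt_comp_consLast hψ x t).deriv]
  rw [e, key]
  ring

/-- Horizontal shifts preserve the strip, which is why horizontal integration by parts has no
boundary term. -/
theorem mem_strip_add_smul_single {i : Fin d} {y : RSpace (d + 1)} {τ : ℝ} :
    y + τ • EuclideanSpace.single i.castSucc 1 ∈ strip d bm bp ↔ y ∈ strip d bm bp := by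
  have : (Fin.last d) ≠ i.castSucc := (Fin.castSucc_lt_last i).ne'
  simp [strip, this]

/-- Integration by parts in a horizontal direction: there is no boundary term. -/
theorem IsTracePair.integral_horizontal (hp : 1 < p) (hab : bm < bp)
    (H : IsSobolevPair p bm bp u g) {fm fp : RSpace d → ℝ}
    (T : IsTracePair bm bp u (g (Fin.last d)) fm fp)
    {ψ : RSpace (d + 1) → ℝ} (hψ : ContDiff ℝ 1 ψ) (hc : HasCompactSupport ψ) (i : Fin d) :
    ∫ y in strip d bm bp, u y * classicalPartial i.castSucc ψ y =
      -(∫ y in strip d bm bp, ψ y * g i.castSucc y) := by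
  set e : RSpace (d + 1) := EuclideanSpace.single i.castSucc 1 with he
  have hen : ‖e‖ = 1 := by simp [he]
  obtain ⟨R, hR⟩ := hc.isCompact.isBounded.subset_closedBall (0 : RSpace (d + 1))
  have hRs : ∀ y, ψ y ≠ 0 → ‖y‖ ≤ R := fun y hy => by
    simpa using hR (subset_tsupport _ hy)
  -- The margin of one keeps all translates of the support of $\psi$ by $\tau e$ with $|\tau|\le1$
  -- inside $B$.
  set B := Metric.closedBall (0 : RSpace (d + 1)) (R + 1) with hB
  have hBc : IsCompact B := isCompact_closedBall _ _
  set S := strip d bm bp ∩ B with hS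
  have hSm : MeasurableSet S := (isOpen_strip bm bp).measurableSet.inter measurableSet_closedBall
  set uS := S.indicator u
  set gS := S.indicator (g i.castSucc)
  have huS : Integrable uS :=
    (integrable_indicator_iff hSm).2 (T.integrableOn_strip hp hab H hBc)
  have hgS : Integrable gS :=
    (integrable_indicator_iff hSm).2 (H.integrableOn_partial_strip hp _ hBc)
  have hBmem : ∀ y, ψ y ≠ 0 → ∀ s : ℝ, |s| ≤ 1 → y + s • e ∈ B := by
    intro y hy s hs
    rw [hB, mem_closedBall_zero_iff]
    calc ‖y + s • e‖ ≤ ‖y‖ + ‖s • e‖ := norm_add_le _ _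
      _ ≤ R + 1 := add_le_add (hRs y hy) (by rw [norm_smul, hen, mul_one]; exact hs)
  obtain ⟨C, hC⟩ := hc.exists_bound_of_continuous hψ.continuous
  have hψcont := hψ.continuous
  have hDcont : Continuous (fderiv ℝ ψ) := hψ.continuous_fderiv (by simp)
  obtain ⟨C', hC'⟩ := (hc.fderiv (𝕜 := ℝ)).exists_bound_of_continuous hDcont
  -- The support of $\psi$ may meet the boundary, so the definition of weak derivative does not
  -- apply to $\psi$. Instead $L'(0)$ is computed twice: with the derivative falling on $\psi$, and
  -- from the difference formula for $u$, which gives $\Phi(0)$.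
  set L : ℝ → ℝ := fun τ => ∫ y, uS y * ψ (y - τ • e) with hL
  set Φ : ℝ → ℝ := fun s => ∫ y, gS y * ψ (y - s • e) with hΦ
  have hΦc : Continuous Φ := by
    refine continuous_of_dominated (bound := fun y => ‖gS y‖ * C) (fun s => ?_) (fun s => ?_) ?_ ?_
    · exact hgS.aestronglyMeasurable.mul (by fun_prop)
    · exact Filter.Eventually.of_forall fun y => by
        rw [norm_mul]; exact mul_le_mul_of_nonneg_left (hC _) (norm_nonneg _)
    · exact hgS.norm.mul_const _
    · exact Filter.Eventually.of_forall fun y => by fun_prop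
  have hLint : ∀ τ : ℝ, Integrable fun y => uS y * ψ (y - τ • e) := fun τ =>
    huS.mul_bdd (c := C) (by fun_prop) (Filter.Eventually.of_forall fun y => hC _)
  have hLD : HasDerivAt L (-∫ y, uS y * fderiv ℝ ψ y e) 0 := by
    have := (hasDerivAt_integral_of_dominated_loc_of_deriv_le (μ := volume) (x₀ := (0 : ℝ))
      (s := univ) (bound := fun y => ‖uS y‖ * (C' * ‖e‖))
      (F := fun τ y => uS y * ψ (y - τ • e))
      (F' := fun τ y => uS y * (-(fderiv ℝ ψ (y - τ • e) e))) Filter.univ_mem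
      (Filter.Eventually.of_forall fun τ => (hLint τ).aestronglyMeasurable) (hLint 0)
      ?_ ?_ ?_ ?_).2
    · simpa [integral_neg] using this
    · exact huS.aestronglyMeasurable.mul (by fun_prop)
    · refine Filter.Eventually.of_forall fun y τ _ => ?_
      rw [norm_mul, norm_neg]
      exact mul_le_mul_of_nonneg_left ((ContinuousLinearMap.le_opNorm _ _).trans
        (mul_le_mul_of_nonneg_right (hC' _) (norm_nonneg _))) (norm_nonneg _)
    · exact huS.norm.mul_const _
    · refine Filter.Eventually.of_forall fun y τ _ => HasDerivAt.const_mul _ ?_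
      have h1 : HasDerivAt (fun τ : ℝ => y - τ • e) (-e) τ := by
        simpa using ((hasDerivAt_id τ).smul_const e).const_sub y
      have h2 := ((hψ.differentiable (by simp)) (y - τ • e)).hasFDerivAt.comp_hasDerivAt τ h1
      simpa [Function.comp_def] using h2
  -- The shift is moved onto $u$, whose increments are integrals of its weak derivative; Fubini and
  -- the substitution $s=\theta\tau$ produce $\Phi$.
  have hLI : ∀ τ : ℝ, |τ| ≤ 1 → L τ = L 0 + ∫ s in (0 : ℝ)..τ, Φ s := by
    intro τ hτ
    have hdiff := ae_strip_sub_eq_integral H.isLocLp H.isWeakPartial (τ • e)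
    have hshift : L τ = ∫ y, uS (y + τ • e) * ψ y := by
      simp only [hL]
      rw [← integral_add_right_eq_self (fun y => uS y * ψ (y - τ • e)) (τ • e)]
      simp
    have hL0 : L 0 = ∫ y, uS y * ψ y := by simp [hL]
    have hi1 : Integrable fun y => uS (y + τ • e) * ψ y :=
      (huS.comp_add_right (τ • e)).mul_bdd (c := C) (by fun_prop) (Filter.Eventually.of_forall hC)
    have hi2 : Integrable fun y => uS y * ψ y :=
      huS.mul_bdd (c := C) (by fun_prop) (Filter.Eventually.of_forall hC)
    have hpt : ∀ᵐ y, uS (y + τ • e) * ψ y - uS y * ψ y =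
        τ * ((∫ θ in Icc (0 : ℝ) 1, gS (y + θ • (τ • e))) * ψ y) := by
      filter_upwards [hdiff] with y hy
      by_cases h0 : ψ y = 0
      · simp [h0]
      have hs1 : y ∈ B := by simpa using hBmem y h0 0 (by simp)
      by_cases hys : y ∈ strip d bm bp
      · have hy2 : y + τ • e ∈ strip d bm bp := mem_strip_add_smul_single.2 hys
        have e1 : uS (y + τ • e) = u (y + τ • e) := indicator_of_mem (s := S) ⟨hy2, hBmem y h0 τ hτ⟩ u
        have e2 : uS y = u y := indicator_of_mem (s := S) ⟨hys, hs1⟩ u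
        rw [e1, e2, ← sub_mul, hy hys hy2, ← mul_assoc, ← integral_const_mul]
        congr 1
        refine setIntegral_congr_fun measurableSet_Icc fun θ hθ => ?_
        have e3 : gS (y + θ • (τ • e)) = g i.castSucc (y + θ • (τ • e)) := by
          rw [smul_smul]
          refine indicator_of_mem (s := S)
            ⟨mem_strip_add_smul_single.2 hys, hBmem y h0 _ ?_⟩ (g i.castSucc)
          rw [abs_mul, abs_of_nonneg hθ.1]
          nlinarith [hθ.1, hθ.2, abs_nonneg τ]
        simp only [e3]
        rw [Finset.sum_eq_single i.castSucc]
        · simp [he]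
        · intro j _ hj
          simp [he, hj]
        · simp
      · have h1 : ∀ s : ℝ, y + s • e ∉ S := fun s h => hys (mem_strip_add_smul_single.1 h.1)
        have e1 : uS (y + τ • e) = 0 := indicator_of_notMem (h1 τ) _
        have e2 : uS y = 0 := indicator_of_notMem (by simpa using h1 0) _
        have e3 : ∀ θ : ℝ, gS (y + θ • (τ • e)) = 0 := fun θ => by
          rw [smul_smul]; exact indicator_of_notMem (h1 _) _
        simp [e1, e2, e3]
    rw [← sub_eq_iff_eq_add', hshift, hL0, ← integral_sub hi1 hi2, integral_congr_ae hpt,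
      integral_const_mul, integral_mul_integral_translate hgS hψ.continuous hc,
      integral_Icc_eq_integral_Ioc, ← intervalIntegral.integral_of_le zero_le_one]
    simp_rw [smul_smul]
    have := intervalIntegral.mul_integral_comp_mul_right (a := 0) (b := 1) (f := Φ) τ
    rw [zero_mul, one_mul] at this
    exact this
  have hLD' : HasDerivAt L (Φ 0) 0 := by
    have h1 : HasDerivAt (fun τ => L 0 + ∫ s in (0 : ℝ)..τ, Φ s) (Φ 0) 0 :=
      (intervalIntegral.integral_hasDerivAt_right (hΦc.intervalIntegrable _ _)
        hΦc.aestronglyMeasurable.stronglyMeasurableAtFilter hΦc.continuousAt).const_add _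
    refine h1.congr_of_eventuallyEq ?_
    filter_upwards [Metric.closedBall_mem_nhds (0 : ℝ) one_pos] with τ hτ
    exact hLI τ (by simpa using hτ)
  have huniq := hLD.unique hLD'
  have ext : ∀ F θ : RSpace (d + 1) → ℝ, (∀ y, y ∉ B → θ y = 0) →
      ∫ y, S.indicator F y * θ y = ∫ y in strip d bm bp, F y * θ y := by
    intro F θ hθ
    rw [← integral_indicator (isOpen_strip bm bp).measurableSet]
    congr 1 with y
    by_cases h1 : y ∈ strip d bm bp <;> by_cases h2 : y ∈ B
    · simp [hS, h1, h2]
    · simp [h1, hθ y h2]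
    · simp [hS, h1]
    · simp [h1, hθ y h2]
  have hψB : ∀ y, y ∉ B → ψ y = 0 := fun y hy => by
    by_contra h
    exact hy (by simpa using hBmem y h 0 (by simp))
  have hDB : ∀ y, y ∉ B → fderiv ℝ ψ y e = 0 := fun y hy => by
    have : fderiv ℝ ψ y = 0 := image_eq_zero_of_notMem_tsupport fun h => hy (by
      have := hR (tsupport_fderiv_subset ℝ h)
      exact Metric.closedBall_subset_closedBall (by linarith) this)
    rw [this]; rfl
  rw [ext u _ hDB, hΦ] at huniq
  simp only [zero_smul, sub_zero] at huniq
  rw [ext _ _ hψB] at huniq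
  simp_rw [mul_comm (ψ _) (g _ _)]
  rw [← huniq, neg_neg]
  rfl

end

/-! ### The boundary measure and the trace of a single function -/

section


variable {d : ℕ} {p bm bp : ℝ}

theorem isOpenMap_last : IsOpenMap fun y : RSpace (d + 1) => y (Fin.last d) :=
  (EuclideanSpace.proj (𝕜 := ℝ) (ι := Fin (d + 1)) (Fin.last d)).isOpenMap
    fun t => ⟨consLast 0 t, by simp⟩

theorem continuous_last : Continuous fun y : RSpace (d + 1) => y (Fin.last d) := by fun_prop

theorem measurableSet_last_eq (b : ℝ) : MeasurableSet {y : RSpace (d + 1) | y (Fin.last d) = b} :=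
  (continuous_last (d := d)).measurable (measurableSet_singleton b)

theorem strip_eq_preimage (d : ℕ) (bm bp : ℝ) :
    strip d bm bp = (fun y : RSpace (d + 1) => y (Fin.last d)) ⁻¹' Ioo bm bp := rfl

theorem frontier_strip (hab : bm < bp) :
    frontier (strip d bm bp) = {y | y (Fin.last d) = bm} ∪ {y | y (Fin.last d) = bp} := by
  rw [strip_eq_preimage, ← isOpenMap_last.preimage_frontier_eq_frontier_preimage continuous_last,
    frontier_Ioo hab]
  ext y
  simp

theorem consLast_mem_closure_strip (hab : bm < bp) {x : RSpace d} {t : ℝ} (ht : t ∈ Icc bm bp) :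
    consLast x t ∈ closure (strip d bm bp) := by
  rw [strip_eq_preimage, ← isOpenMap_last.preimage_closure_eq_closure_preimage continuous_last,
    closure_Ioo hab.ne]
  simpa using ht

theorem range_consLast (b : ℝ) :
    range (fun x : RSpace d => consLast x b) = {y | y (Fin.last d) = b} := by
  ext y
  constructor
  · rintro ⟨x, rfl⟩
    simp
  · rintro rfl
    exact ⟨horiz y, consLast_horiz y⟩

/-- The surface measure is Lebesgue measure on each of the two boundary planes. -/
theorem bdryMeasure_eq (hab : bm < bp) : bdryMeasure d bm bp =
    (volume : Measure (RSpace d)).map (fun x => consLast x bm) +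
      (volume : Measure (RSpace d)).map (fun x => consLast x bp) := by
  rw [bdryMeasure, frontier_strip hab, Measure.restrict_union _ (measurableSet_last_eq bp)]
  · rw [← range_consLast, ← range_consLast, ← (isometry_consLast bm).map_euclideanHausdorffMeasure,
      ← (isometry_consLast bp).map_euclideanHausdorffMeasure,
      EuclideanSpace.euclideanHausdorffMeasure_eq_volume]
  · rw [disjoint_left]
    rintro y (h1 : y _ = bm) (h2 : y _ = bp)
    exact hab.ne (h1.symm.trans h2)

theorem measurableEmbedding_consLast (b : ℝ) :
    MeasurableEmbedding fun x : RSpace d => consLast x b :=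
  (isometry_consLast b).isClosedEmbedding.measurableEmbedding

theorem ae_bdryMeasure_iff (hab : bm < bp) {P : RSpace (d + 1) → Prop} :
    (∀ᵐ y ∂bdryMeasure d bm bp, P y) ↔
      (∀ᵐ x : RSpace d, P (consLast x bm)) ∧ ∀ᵐ x : RSpace d, P (consLast x bp) := by
  rw [bdryMeasure_eq hab, ae_add_measure_iff, (measurableEmbedding_consLast bm).ae_map_iff,
    (measurableEmbedding_consLast bp).ae_map_iff]

theorem integrable_bdryMeasure_iff (hab : bm < bp) {F : RSpace (d + 1) → ℝ} :
    Integrable F (bdryMeasure d bm bp) ↔ Integrable (fun x : RSpace d => F (consLast x bm)) ∧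
      Integrable fun x : RSpace d => F (consLast x bp) := by
  rw [bdryMeasure_eq hab, integrable_add_measure,
    (measurableEmbedding_consLast bm).integrable_map_iff,
    (measurableEmbedding_consLast bp).integrable_map_iff]
  rfl

theorem integral_bdryMeasure (hab : bm < bp) {F : RSpace (d + 1) → ℝ}
    (hF : Integrable F (bdryMeasure d bm bp)) : ∫ y, F y ∂bdryMeasure d bm bp =
      (∫ x : RSpace d, F (consLast x bm)) + ∫ x : RSpace d, F (consLast x bp) := by
  rw [bdryMeasure_eq hab, integrable_add_measure] at hF
  rw [bdryMeasure_eq hab, integral_add_measure hF.1 hF.2,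
    (measurableEmbedding_consLast bm).integral_map, (measurableEmbedding_consLast bp).integral_map]

theorem lintegral_bdryMeasure_restrict (hab : bm < bp) {F : RSpace (d + 1) → ℝ≥0∞}
    (K : Set (RSpace (d + 1))) :
    ∫⁻ y in K, F y ∂bdryMeasure d bm bp =
      (∫⁻ x in (fun x : RSpace d => consLast x bm) ⁻¹' K, F (consLast x bm)) +
        ∫⁻ x in (fun x : RSpace d => consLast x bp) ⁻¹' K, F (consLast x bp) := by
  rw [bdryMeasure_eq hab, Measure.restrict_add, lintegral_add_measure,
    (measurableEmbedding_consLast bm).restrict_map, (measurableEmbedding_consLast bp).restrict_map,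
    (measurableEmbedding_consLast bm).lintegral_map, (measurableEmbedding_consLast bp).lintegral_map]

theorem isCompact_preimage_consLast {K : Set (RSpace (d + 1))} (hK : IsCompact K) (b : ℝ) :
    IsCompact ((fun x : RSpace d => consLast x b) ⁻¹' K) :=
  (isometry_consLast b).isClosedEmbedding.isCompact_preimage hK

theorem isFiniteMeasureOnCompacts_bdryMeasure (hab : bm < bp) :
    IsFiniteMeasureOnCompacts (bdryMeasure d bm bp) := by
  refine ⟨fun K hK => ?_⟩
  have := lintegral_bdryMeasure_restrict (d := d) hab (F := fun _ => 1) K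
  simp only [lintegral_const, one_mul, Measure.restrict_apply_univ] at this
  rw [this]
  exact ENNReal.add_lt_top.2 ⟨(isCompact_preimage_consLast hK bm).measure_lt_top,
    (isCompact_preimage_consLast hK bp).measure_lt_top⟩

theorem restrict_bdryMeasure_of_subset {K : Set (RSpace (d + 1))} (hK : MeasurableSet K)
    (hKf : K ⊆ frontier (strip d bm bp)) :
    (bdryMeasure d bm bp).restrict K = (μHE[d] : Measure (RSpace (d + 1))).restrict K := by
  rw [bdryMeasure, Measure.restrict_restrict hK, inter_eq_left.2 hKf]

/-- The function on the boundary with values `fm` on the bottom and `fp` on the top. -/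
noncomputable def bdryFun (bp : ℝ) (fm fp : RSpace d → ℝ) (y : RSpace (d + 1)) : ℝ :=
  if y (Fin.last d) = bp then fp (horiz y) else fm (horiz y)

theorem measurable_bdryFun {fm fp : RSpace d → ℝ} (hm : Measurable fm) (hp : Measurable fp) :
    Measurable (bdryFun bp fm fp) := by
  have hh := (continuous_horiz (d := d)).measurable
  exact Measurable.ite (measurableSet_last_eq bp) (hp.comp hh) (hm.comp hh)

theorem bdryFun_top (fm fp : RSpace d → ℝ) (x : RSpace d) :
    bdryFun bp fm fp (consLast x bp) = fp x := by simp [bdryFun]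

theorem bdryFun_bot (hab : bm < bp) (fm fp : RSpace d → ℝ) (x : RSpace d) :
    bdryFun bp fm fp (consLast x bm) = fm x := by simp [bdryFun, hab.ne]

theorem isLocLp_bdryFun (hab : bm < bp) (hp : 0 < p) {fm fp : RSpace d → ℝ} (hm : Measurable fm)
    (hp' : Measurable fp)
    (hfm : ∀ K, IsCompact K → MemLp fm (ENNReal.ofReal p) (volume.restrict K))
    (hfp : ∀ K, IsCompact K → MemLp fp (ENNReal.ofReal p) (volume.restrict K)) :
    IsLocLp (ENNReal.ofReal p) μHE[d] (frontier (strip d bm bp)) (bdryFun bp fm fp) := by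
  intro K hK hKf
  rw [← restrict_bdryMeasure_of_subset hK.measurableSet hKf]
  have hp0 : ENNReal.ofReal p ≠ 0 := by simpa using hp
  refine ⟨(measurable_bdryFun hm hp').aestronglyMeasurable, ?_⟩
  rw [eLpNorm_lt_top_iff_lintegral_rpow_enorm_lt_top hp0 ENNReal.ofReal_ne_top,
    lintegral_bdryMeasure_restrict hab]
  simp only [bdryFun_top, bdryFun_bot hab]
  exact ENNReal.add_lt_top.2
    ⟨(eLpNorm_lt_top_iff_lintegral_rpow_enorm_lt_top hp0 ENNReal.ofReal_ne_top).1
      (hfm _ (isCompact_preimage_consLast hK bm)).2,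
    (eLpNorm_lt_top_iff_lintegral_rpow_enorm_lt_top hp0 ENNReal.ofReal_ne_top).1
      (hfp _ (isCompact_preimage_consLast hK bp)).2⟩

theorem IsWeakPartial.congr_right {n : ℕ} {S : Set (RSpace n)} {i : Fin n} {u g h : RSpace n → ℝ}
    (hg : IsWeakPartial S i u g) (e : g =ᵐ[volume.restrict S] h) : IsWeakPartial S i u h := by
  refine ⟨hg.1.congr e, fun φ h1 h2 h3 => ?_⟩
  rw [hg.2 φ h1 h2 h3]
  congr 1
  refine integral_congr_ae ?_
  filter_upwards [e] with x hx
  rw [hx]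

/-- Weak partial derivatives are unique almost everywhere. -/
theorem IsWeakPartial.ae_eq {n : ℕ} {U : Set (RSpace n)} (hU : IsOpen U) {i : Fin n}
    {u g h : RSpace n → ℝ} (hg : IsWeakPartial U i u g) (hh : IsWeakPartial U i u h) :
    g =ᵐ[volume.restrict U] h := by
  have key : ∀ᵐ x, x ∈ U → g x - h x = 0 := by
    refine hU.ae_eq_zero_of_integral_contDiff_smul_eq_zero ?_ ?_
    · rw [locallyIntegrableOn_iff hU.isLocallyClosed]
      exact fun K hKU hK => (hg.1.integrableOn hK hKU).sub (hh.1.integrableOn hK hKU)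
    · intro φ h1 h2 h3
      have e : ∫ x, φ x • (g x - h x) = ∫ x in U, (g x * φ x - h x * φ x) := by
        rw [← integral_indicator hU.measurableSet]
        congr 1 with x
        by_cases hx : x ∈ U
        · simp [hx]; ring
        · simp [hx, image_eq_zero_of_notMem_tsupport fun hx' => hx (h3 hx')]
      rw [e, integral_sub (hg.1.integrableOn_mul h1.continuous h2 h3)
        (hh.1.integrableOn_mul h1.continuous h2 h3)]
      have := (hg.2 φ h1 h2 h3).symm.trans (hh.2 φ h1 h2 h3)
      linarith
  rw [Filter.EventuallyEq, ae_restrict_iff' hU.measurableSet]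
  filter_upwards [key] with x hx hxU using sub_eq_zero.1 (hx hxU)

/-- `weakPartial` is obtained by choice, so it is additive only almost everywhere, through
uniqueness of weak derivatives. -/
theorem weakPartial_add (u v : HomSobolev p (strip d bm bp)) (i : Fin (d + 1)) :
    weakPartial (u + v) i =ᵐ[volume.restrict (strip d bm bp)]
      weakPartial u i + weakPartial v i := by
  refine (weakPartial_spec (u + v) i).2.ae_eq (isOpen_strip bm bp) ?_
  exact (IsWeakPartial.add u.2.1 v.2.1 (weakPartial_spec u i).2 (weakPartial_spec v i).2).congr
    (AEEqFun.coeFn_add u.1 v.1).symm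

theorem weakPartial_smul (c : ℝ) (u : HomSobolev p (strip d bm bp)) (i : Fin (d + 1)) :
    weakPartial (c • u) i =ᵐ[volume.restrict (strip d bm bp)] c • weakPartial u i := by
  refine (weakPartial_spec (c • u) i).2.ae_eq (isOpen_strip bm bp) ?_
  exact (IsWeakPartial.smul c (weakPartial_spec u i).2).congr (AEEqFun.coeFn_smul c u.1).symm

/-- Regular representatives of the weak partial derivatives. -/
theorem exists_isSobolevPair (u : HomSobolev p (strip d bm bp)) :
    ∃ g : Fin (d + 1) → RSpace (d + 1) → ℝ, IsSobolevPair p bm bp u.1 g ∧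
      ∀ i, weakPartial u i =ᵐ[volume.restrict (strip d bm bp)] g i := by
  have hs := fun i => weakPartial_spec u i
  have e := fun i => (hs i).1.1.ae_eq_mk
  refine ⟨fun i => (hs i).1.1.mk _, ⟨u.1.stronglyMeasurable.measurable,
    fun i => (hs i).1.1.stronglyMeasurable_mk.measurable, u.2.1,
    fun i => (hs i).1.ae_eq (e i), fun i => (hs i).2.congr_right (e i)⟩, e⟩

theorem outwardNormal_top (x : RSpace d) :
    outwardNormal d bm bp (consLast x bp) = EuclideanSpace.single (Fin.last d) 1 := by
  simp [outwardNormal]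

theorem outwardNormal_bot (hab : bm < bp) (x : RSpace d) :
    outwardNormal d bm bp (consLast x bm) = -EuclideanSpace.single (Fin.last d) 1 := by
  simp [outwardNormal, hab.ne]

/-- The boundary values are the continuous ones for functions continuous up to the boundary. -/
theorem IsTracePair.eq_of_continuousOn (hab : bm < bp) {u g : RSpace (d + 1) → ℝ}
    {fm fp : RSpace d → ℝ} (T : IsTracePair bm bp u g fm fp) {w : RSpace (d + 1) → ℝ}
    (hw : ContinuousOn w (closure (strip d bm bp))) (huw : u =ᵐ[volume.restrict (strip d bm bp)] w) :
    ∀ᵐ x, fm x = w (consLast x bm) ∧ fp x = w (consLast x bp) := by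
  have h1 := (measurePreserving_consLast_strip (d := d)
    (bm := bm) (bp := bp)).quasiMeasurePreserving.ae huw
  rw [← Measure.prod_restrict, Measure.restrict_univ] at h1
  filter_upwards [Measure.ae_ae_of_ae_prod h1, T.primitive, T.integrableOn] with x hx1 hx2 hxi
  have hint := intervalIntegrable_of_mem_Icc hxi (left_mem_Icc.2 hab.le) (right_mem_Icc.2 hab.le)
  have hc1 : ContinuousOn (fun t => fm x + ∫ s in bm..t, g (consLast x s)) (Icc bm bp) := by
    have := (hint.absolutelyContinuousOnInterval_intervalIntegral left_mem_uIcc).continuousOn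
    rw [uIcc_of_le hab.le] at this
    exact continuousOn_const.add this
  have hc2 : ContinuousOn (fun t => w (consLast x t)) (Icc bm bp) :=
    hw.comp (continuous_consLast.comp (Continuous.prodMk_right x)).continuousOn
      fun t ht => consLast_mem_closure_strip hab ht
  have hae : (fun t => fm x + ∫ s in bm..t, g (consLast x s)) =ᵐ[volume.restrict (Icc bm bp)]
      fun t => w (consLast x t) := by
    rw [← Measure.restrict_congr_set Ioo_ae_eq_Icc]
    filter_upwards [hx1, hx2] with t h3 h4
    rw [← h4]
    exact h3
  -- Continuous functions that agree a.e. on the closed interval agree everywhere on it, in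
  -- particular at the endpoints.
  have heq := Measure.eqOn_of_ae_eq hae hc1 hc2
    (by rw [interior_Icc, closure_Ioo hab.ne])
  constructor
  · simpa using heq (left_mem_Icc.2 hab.le)
  · rw [T.eq_top]
    exact heq (right_mem_Icc.2 hab.le)

/-- Existence of the trace of a single function. -/
theorem exists_trace_apply (hd : 1 ≤ d) {p : ℝ} (hp : 1 < p) : ∃ c : ℝ, 0 < c ∧
    ∀ bm bp : ℝ, bm < bp → ∀ u : HomSobolev p (strip d bm bp), ∃ F : LpLocBdry d p bm bp,
    (∀ w : RSpace (d + 1) → ℝ, ContinuousOn w (closure (strip d bm bp)) →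
      u.1 =ᵐ[volume.restrict (strip d bm bp)] w → F.1 =ᵐ[bdryMeasure d bm bp] w) ∧
    (∫⁻ x' : RSpace d, ‖F.1 (consLast x' bp) - F.1 (consLast x' bm)‖ₑ ^ p ≤
      ENNReal.ofReal ((bp - bm) ^ (p - 1)) *
        ∫⁻ x in strip d bm bp, ‖weakPartial u (Fin.last d) x‖ₑ ^ p) ∧
    (∀ b : ℝ, b = bm ∨ b = bp →
      (screenedSeminorm (1 - 1 / p) p (bp - bm) fun x' : RSpace d => F.1 (consLast x' b)) ^ p ≤
        ENNReal.ofReal c * ∫⁻ x in strip d bm bp, ‖weakGradient u x‖ₑ ^ p) ∧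
    ∀ ψ : RSpace (d + 1) → ℝ, ContDiff ℝ 1 ψ → HasCompactSupport ψ → ∀ i : Fin (d + 1),
      IntegrableOn (fun x => u.1 x * classicalPartial i ψ x) (strip d bm bp) ∧
      IntegrableOn (fun x => ψ x * weakPartial u i x) (strip d bm bp) ∧
      Integrable (fun x => ψ x * F.1 x * outwardNormal d bm bp x i) (bdryMeasure d bm bp) ∧
      ∫ x in strip d bm bp, u.1 x * classicalPartial i ψ x =
        -(∫ x in strip d bm bp, ψ x * weakPartial u i x) +
          ∫ x, ψ x * F.1 x * outwardNormal d bm bp x i ∂(bdryMeasure d bm bp) := by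
  have hp0 : 0 < p := by linarith
  obtain ⟨C, hC, hscreen⟩ := exists_screened_trace_bound hd hp
  -- Adding one makes the constant positive even if $C=0$.
  refine ⟨C.toReal + 1, by positivity, fun bm bp hab u => ?_⟩
  obtain ⟨g, H, hgu⟩ := exists_isSobolevPair u
  obtain ⟨fm, fp, T⟩ := H.exists_tracePair hp hab
  have hsc : ∀ f, f = fm ∨ f = fp → ∫⁻ x : RSpace d, ∫⁻ h in Metric.ball (0 : RSpace d) (bp - bm),
      ‖f (x + h) - f x‖ₑ ^ p / ‖h‖ₑ ^ ((1 - 1 / p) * p + d) ≤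
        C * ∫⁻ y in strip d bm bp, ‖fieldOf g y‖ₑ ^ p := fun f hf =>
    hscreen bm bp u.1 g fm fp hab H T f hf
  have hfield : ∀ᵐ y ∂volume.restrict (strip d bm bp), weakGradient u y = fieldOf g y := by
    filter_upwards [ae_all_iff.2 hgu] with y hy
    simp only [weakGradient, fieldOf, hy]
  have hfin : ∫⁻ y in strip d bm bp, ‖fieldOf g y‖ₑ ^ p ≠ ⊤ := by
    have h1 : MemLp (fieldOf g) (ENNReal.ofReal p) (volume.restrict (strip d bm bp)) := by
      refine (memLp_finsetSum' Finset.univ fun i _ =>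
        (H.memLp_partial i).norm).mono
          (measurable_fieldOf H.measurable_partial).aestronglyMeasurable ?_
      refine Filter.Eventually.of_forall fun y => ?_
      rw [Finset.sum_apply, Real.norm_of_nonneg (Finset.sum_nonneg fun _ _ => norm_nonneg _)]
      have : fieldOf g y = ∑ i, EuclideanSpace.single i (g i y) := by
        ext j
        simp [fieldOf, Finset.sum_apply, Pi.single_apply]
      rw [this]
      refine (norm_sum_le _ _).trans_eq ?_
      simp
    have h2 := (eLpNorm_lt_top_iff_lintegral_rpow_enorm_lt_top (by simpa using hp0)
      ENNReal.ofReal_ne_top).1 h1.2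
    rw [ENNReal.toReal_ofReal hp0.le] at h2
    exact h2.ne
  -- Membership in local $L^p$ comes from the seminorm bound: the right side is finite, and the end
  -- values are already locally integrable.
  have hloc := isLocLp_bdryFun hab hp0 T.measurable_bot T.measurable_top
    (fun K hK => memLp_of_screened hp (sub_pos.2 hab) T.measurable_bot
      (fun K hK => T.integrableOn_bot hp hab H hK)
      (ne_top_of_le_ne_top (ENNReal.mul_ne_top hC hfin) (hsc fm (Or.inl rfl))) hK)
    (fun K hK => memLp_of_screened hp (sub_pos.2 hab) T.measurable_top
      (fun K hK => T.integrableOn_top hp hab H hK)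
      (ne_top_of_le_ne_top (ENNReal.mul_ne_top hC hfin) (hsc fp (Or.inr rfl))) hK)
  have hmeas : AEStronglyMeasurable (bdryFun bp fm fp) (bdryMeasure d bm bp) :=
    (measurable_bdryFun T.measurable_bot T.measurable_top).aestronglyMeasurable
  have hmk : (AEEqFun.mk _ hmeas : RSpace (d + 1) →ₘ[bdryMeasure d bm bp] ℝ)
      =ᵐ[bdryMeasure d bm bp] bdryFun bp fm fp := AEEqFun.coeFn_mk _ hmeas
  refine ⟨⟨AEEqFun.mk _ hmeas, hloc.congr hmk.symm⟩, ?_⟩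
  set F : RSpace (d + 1) →ₘ[bdryMeasure d bm bp] ℝ := AEEqFun.mk _ hmeas with hF
  obtain ⟨hbot, htop⟩ := (ae_bdryMeasure_iff hab).1 hmk
  simp only [bdryFun_bot hab] at hbot
  simp only [bdryFun_top] at htop
  refine ⟨fun w hw huw => ?_, ?_, fun b hb => ?_, fun ψ hψ hc i => ?_⟩
  · have := T.eq_of_continuousOn hab hw huw
    refine (ae_bdryMeasure_iff hab).2 ⟨?_, ?_⟩
    · filter_upwards [hbot, this] with x h1 h2
      exact h1.trans h2.1
    · filter_upwards [htop, this] with x h1 h2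
      exact h1.trans h2.2
  · have e1 : ∫⁻ x' : RSpace d, ‖F (consLast x' bp) - F (consLast x' bm)‖ₑ ^ p =
        ∫⁻ x', ‖fp x' - fm x'‖ₑ ^ p := by
      refine lintegral_congr_ae ?_
      filter_upwards [hbot, htop] with x h1 h2
      rw [h1, h2]
    have e2 : ∫⁻ x in strip d bm bp, ‖weakPartial u (Fin.last d) x‖ₑ ^ p =
        ∫⁻ x in strip d bm bp, ‖g (Fin.last d) x‖ₑ ^ p := by
      refine lintegral_congr_ae ?_
      filter_upwards [hgu (Fin.last d)] with x h1
      rw [h1]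
    rw [e2]
    exact e1.trans_le (T.lintegral_sub_le hp hab H)
  -- The seminorm ignores null sets: for almost every fixed $x$, the point $x+h$ is also good for
  -- almost every $h$.
  · have e1 : ∀ f : RSpace d → ℝ, (∀ᵐ x, F (consLast x b) = f x) →
        ∫⁻ x : RSpace d, ∫⁻ h in Metric.ball (0 : RSpace d) (bp - bm),
          ‖F (consLast (x + h) b) - F (consLast x b)‖ₑ ^ p / ‖h‖ₑ ^ ((1 - 1 / p) * p + d) =
        ∫⁻ x : RSpace d, ∫⁻ h in Metric.ball (0 : RSpace d) (bp - bm),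
          ‖f (x + h) - f x‖ₑ ^ p / ‖h‖ₑ ^ ((1 - 1 / p) * p + d) := by
      intro f hf
      refine lintegral_congr_ae ?_
      filter_upwards [hf] with x hx
      refine lintegral_congr_ae (ae_restrict_of_ae ?_)
      filter_upwards [(quasiMeasurePreserving_add_left (volume : Measure (RSpace d)) x).ae hf]
        with h hh
      rw [hx, hh]
    have e2 : ∫⁻ x in strip d bm bp, ‖weakGradient u x‖ₑ ^ p =
        ∫⁻ x in strip d bm bp, ‖fieldOf g x‖ₑ ^ p := by
      refine lintegral_congr_ae ?_
      filter_upwards [hfield] with x h1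
      rw [h1]
    have hCle : C ≤ ENNReal.ofReal (C.toReal + 1) := by
      conv_lhs => rw [← ENNReal.ofReal_toReal hC]
      exact ENNReal.ofReal_le_ofReal (by linarith)
    rw [screenedSeminorm, ← ENNReal.rpow_mul, one_div_mul_cancel hp0.ne', ENNReal.rpow_one, e2]
    refine le_trans ?_ (mul_le_mul_left hCle _)
    rcases hb with rfl | rfl
    · exact (e1 fm hbot).trans_le (hsc fm (Or.inl rfl))
    · exact (e1 fp htop).trans_le (hsc fp (Or.inr rfl))
  · have hI1 : IntegrableOn (fun x => u.1 x * classicalPartial i ψ x) (strip d bm bp) :=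
      integrableOn_strip_mul (fun B hB => T.integrableOn_strip hp hab H hB)
        (continuous_classicalPartial_of_one hψ _) (hasCompactSupport_classicalPartial hc _)
    have hI2 : IntegrableOn (fun x => g i x * ψ x) (strip d bm bp) :=
      integrableOn_strip_mul (fun B hB => H.integrableOn_partial_strip hp _ hB) hψ.continuous hc
    have hI3 := integrable_mul_slice (fun K hK => T.integrableOn_top hp hab H hK)
      hψ.continuous hc bp
    have hI4 := integrable_mul_slice (fun K hK => T.integrableOn_bot hp hab H hK)
      hψ.continuous hc bm
    have eg : (fun x => g i x * ψ x) =ᵐ[volume.restrict (strip d bm bp)]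
        fun x => ψ x * weakPartial u i x := by
      filter_upwards [hgu i] with x hx
      rw [hx, mul_comm]
    have ebot : (fun x : RSpace d => ψ (consLast x bm) * F (consLast x bm) *
        outwardNormal d bm bp (consLast x bm) i) =ᵐ[volume] fun x =>
          (ψ (consLast x bm) * fm x) * (-EuclideanSpace.single (Fin.last d) (1 : ℝ)) i := by
      filter_upwards [hbot] with x hx
      rw [hx, outwardNormal_bot hab]
    have etop : (fun x : RSpace d => ψ (consLast x bp) * F (consLast x bp) *
        outwardNormal d bm bp (consLast x bp) i) =ᵐ[volume] fun x =>
          (ψ (consLast x bp) * fp x) * (EuclideanSpace.single (Fin.last d) (1 : ℝ)) i := by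
      filter_upwards [htop] with x hx
      rw [hx, outwardNormal_top]
    have hI5 : Integrable (fun x => ψ x * F x * outwardNormal d bm bp x i)
        (bdryMeasure d bm bp) :=
      (integrable_bdryMeasure_iff hab).2
        ⟨(hI4.mul_const _).congr ebot.symm, (hI3.mul_const _).congr etop.symm⟩
    refine ⟨hI1, hI2.congr eg, hI5, ?_⟩
    rw [integral_bdryMeasure hab hI5, integral_congr_ae ebot, integral_congr_ae etop,
      integral_mul_const, integral_mul_const]
    have eg' : ∫ x in strip d bm bp, ψ x * weakPartial u i x =
        ∫ x in strip d bm bp, ψ x * g i x := by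
      rw [← integral_congr_ae eg]
      simp_rw [mul_comm (ψ _)]
    rw [eg']
    -- The normal is vertical. For the last index the two planes enter with opposite signs; for the
    -- others its component is zero and the boundary integral vanishes.
    induction i using Fin.lastCases with
    | last =>
      rw [T.integral_vertical hp hab H hψ hc]
      simp [sub_eq_neg_add]
    | cast j =>
      rw [T.integral_horizontal hp hab H hψ hc j]
      simp [(Fin.castSucc_lt_last j).ne]

/-- A compact $K$ in the ambient space need not lie in $\partial\Omega$. The measure sees only its
intersection with the closed boundary, which is compact and of finite measure, so $L^p\subseteq L^1$
there. -/
theorem locallyIntegrable_bdry (hab : bm < bp) (hp : 1 < p) (F : LpLocBdry d p bm bp) :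
    LocallyIntegrable F.1 (bdryMeasure d bm bp) := by
  have := isFiniteMeasureOnCompacts_bdryMeasure (d := d) hab
  rw [locallyIntegrable_iff]
  intro K hK
  have hf : IsClosed (frontier (strip d bm bp)) := isClosed_frontier
  have hKf := hK.inter_right hf
  have h1 : MemLp F.1 (ENNReal.ofReal p) _ := F.2 _ hKf inter_subset_right
  rw [← restrict_bdryMeasure_of_subset hKf.measurableSet inter_subset_right] at h1
  have hfin : IsFiniteMeasure ((bdryMeasure d bm bp).restrict (K ∩ frontier (strip d bm bp))) :=
    ⟨by rw [Measure.restrict_apply_univ]; exact hKf.measure_lt_top⟩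
  have h2 : IntegrableOn F.1 (K ∩ frontier (strip d bm bp)) (bdryMeasure d bm bp) :=
    h1.integrable (by simpa using hp.le)
  have e : (bdryMeasure d bm bp).restrict K =
      (bdryMeasure d bm bp).restrict (K ∩ frontier (strip d bm bp)) := by
    rw [bdryMeasure, Measure.restrict_restrict hKf.measurableSet, inter_assoc, inter_self,
      Measure.restrict_restrict hK.measurableSet]
  rwa [IntegrableOn, e]

/-- Elements of `L^p_loc(∂Ω)` are determined by their normal moments. -/
theorem bdry_eq_of_integral_eq (hab : bm < bp) (hp : 1 < p) {F F' : LpLocBdry d p bm bp}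
    (h : ∀ ψ : RSpace (d + 1) → ℝ, ContDiff ℝ 1 ψ → HasCompactSupport ψ →
      Integrable (fun x => ψ x * F.1 x * outwardNormal d bm bp x (Fin.last d))
        (bdryMeasure d bm bp) ∧
      Integrable (fun x => ψ x * F'.1 x * outwardNormal d bm bp x (Fin.last d))
        (bdryMeasure d bm bp) ∧
      ∫ x, ψ x * F.1 x * outwardNormal d bm bp x (Fin.last d) ∂(bdryMeasure d bm bp) =
        ∫ x, ψ x * F'.1 x * outwardNormal d bm bp x (Fin.last d) ∂(bdryMeasure d bm bp)) :
    F = F' := by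
  set ν : RSpace (d + 1) → ℝ := fun y =>
    if y (Fin.last d) = bp then 1 else if y (Fin.last d) = bm then -1 else 0 with hν
  have hν' : ∀ y, outwardNormal d bm bp y (Fin.last d) = ν y := by
    intro y
    simp only [outwardNormal, hν]
    split_ifs <;> simp
  simp only [hν'] at h
  have hνm : Measurable ν :=
    Measurable.ite (measurableSet_last_eq bp) measurable_const
      (Measurable.ite (measurableSet_last_eq bm) measurable_const measurable_const)
  have hνb : ∀ y, ‖ν y‖ ≤ 1 := by
    intro y
    simp only [hν]
    split_ifs <;> simp
  have hsub : LocallyIntegrable (fun y => (F.1 y - F'.1 y) * ν y) (bdryMeasure d bm bp) := by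
    intro y
    obtain ⟨s, hs, hi⟩ :=
      (locallyIntegrable_bdry hab hp F).sub (locallyIntegrable_bdry hab hp F') y
    exact ⟨s, hs, hi.mul_bdd (c := 1) hνm.aestronglyMeasurable (Filter.Eventually.of_forall hνb)⟩
  -- The fundamental lemma for the boundary measure gives $(F-F')\nu_N=0$ a.e.; as $\nu_N=\pm1$ on
  -- the two planes, $F=F'$.
  have key := ae_eq_zero_of_integral_contDiff_smul_eq_zero hsub fun ψ hψ hc => by
    obtain ⟨h1, h2, h3⟩ := h ψ (hψ.of_le (by exact_mod_cast le_top)) hc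
    rw [← sub_eq_zero, ← integral_sub h1 h2] at h3
    rw [← h3]
    congr 1 with y
    rw [smul_eq_mul]
    ring
  refine Subtype.ext (AEEqFun.ext ?_)
  rw [ae_bdryMeasure_iff hab] at key
  refine (ae_bdryMeasure_iff hab).2 ⟨?_, ?_⟩
  · filter_upwards [key.1] with x hx
    have hx' : F'.1 (consLast x bm) - F.1 (consLast x bm) = 0 := by
      simpa [hν, hab.ne] using hx
    exact (sub_eq_zero.1 hx').symm
  · filter_upwards [key.2] with x hx
    simpa [hν, sub_eq_zero] using hx

end

end HomogeneousTrace


/-! ### Existence, linearity and uniqueness of the trace operator -/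

theorem theorem1p2 (d : ℕ) (hd : 1 ≤ d) (p : ℝ) (hp : 1 < p) :
    ∃ c : ℝ, 0 < c ∧ ∀ bm bp : ℝ, bm < bp →
      ∃ Tr : HomogeneousTrace.HomSobolev p (HomogeneousTrace.strip d bm bp) →ₗ[ℝ]
          HomogeneousTrace.LpLocBdry d p bm bp,
        HomogeneousTrace.IsStripTrace c Tr ∧
        ∀ (c' : ℝ) (Tr' : HomogeneousTrace.HomSobolev p (HomogeneousTrace.strip d bm bp) →ₗ[ℝ]
            HomogeneousTrace.LpLocBdry d p bm bp),
          0 < c' → HomogeneousTrace.IsStripTrace c' Tr' → Tr' = Tr := by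
  open HomogeneousTrace in
  obtain ⟨c, hc, hex⟩ := exists_trace_apply hd hp
  refine ⟨c, hc, fun bm bp hab => ?_⟩
  choose T h1 h2 h3 h4 using hex bm bp hab
  -- The traces were chosen separately for each $u$, so linearity is not built in. It holds because
  -- $T(u+v)$ and $T u+T v$ have the same normal moments.
  have hadd : ∀ u v, T (u + v) = T u + T v := by
    intro u v
    refine bdry_eq_of_integral_eq hab hp fun ψ hψ hψc => ?_
    obtain ⟨a1, a2, a3, a4⟩ := h4 (u + v) ψ hψ hψc (Fin.last d)
    obtain ⟨b1, b2, b3, b4⟩ := h4 u ψ hψ hψc (Fin.last d)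
    obtain ⟨e1, e2, e3, e4⟩ := h4 v ψ hψ hψc (Fin.last d)
    have eF : (fun x => ψ x * (T u).1 x * outwardNormal d bm bp x (Fin.last d) +
        ψ x * (T v).1 x * outwardNormal d bm bp x (Fin.last d)) =ᵐ[bdryMeasure d bm bp]
        fun x => ψ x * (T u + T v).1 x * outwardNormal d bm bp x (Fin.last d) := by
      filter_upwards [AEEqFun.coeFn_add (T u).1 (T v).1] with x hx
      have : (T u + T v).1 x = (T u).1 x + (T v).1 x := hx
      rw [this]
      ring
    have eu : (fun x => (u + v).1 x * classicalPartial (Fin.last d) ψ x)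
        =ᵐ[volume.restrict (strip d bm bp)] fun x =>
          u.1 x * classicalPartial (Fin.last d) ψ x + v.1 x * classicalPartial (Fin.last d) ψ x := by
      filter_upwards [AEEqFun.coeFn_add u.1 v.1] with x hx
      have : (u + v).1 x = u.1 x + v.1 x := hx
      rw [this]
      ring
    have eg : (fun x => ψ x * weakPartial (u + v) (Fin.last d) x)
        =ᵐ[volume.restrict (strip d bm bp)] fun x =>
          ψ x * weakPartial u (Fin.last d) x + ψ x * weakPartial v (Fin.last d) x := by
      filter_upwards [weakPartial_add u v (Fin.last d)] with x hx
      rw [hx, Pi.add_apply]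
      ring
    refine ⟨a3, (b3.add e3).congr eF, ?_⟩
    rw [integral_congr_ae eu, integral_congr_ae eg, integral_add b1 e1, integral_add b2 e2] at a4
    rw [← integral_congr_ae eF, integral_add b3 e3]
    linarith
  have hsmul : ∀ (r : ℝ) u, T (r • u) = r • T u := by
    intro r u
    refine bdry_eq_of_integral_eq hab hp fun ψ hψ hψc => ?_
    obtain ⟨a1, a2, a3, a4⟩ := h4 (r • u) ψ hψ hψc (Fin.last d)
    obtain ⟨b1, b2, b3, b4⟩ := h4 u ψ hψ hψc (Fin.last d)
    have eF : (fun x => r * (ψ x * (T u).1 x * outwardNormal d bm bp x (Fin.last d)))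
        =ᵐ[bdryMeasure d bm bp]
        fun x => ψ x * (r • T u).1 x * outwardNormal d bm bp x (Fin.last d) := by
      filter_upwards [AEEqFun.coeFn_smul r (T u).1] with x hx
      have : (r • T u).1 x = r * (T u).1 x := hx
      rw [this]
      ring
    have eu : (fun x => (r • u).1 x * classicalPartial (Fin.last d) ψ x)
        =ᵐ[volume.restrict (strip d bm bp)] fun x =>
          r * (u.1 x * classicalPartial (Fin.last d) ψ x) := by
      filter_upwards [AEEqFun.coeFn_smul r u.1] with x hx
      have : (r • u).1 x = r * u.1 x := hx
      rw [this]
      ring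
    have eg : (fun x => ψ x * weakPartial (r • u) (Fin.last d) x)
        =ᵐ[volume.restrict (strip d bm bp)] fun x =>
          r * (ψ x * weakPartial u (Fin.last d) x) := by
      filter_upwards [weakPartial_smul r u (Fin.last d)] with x hx
      rw [hx, Pi.smul_apply, smul_eq_mul]
      ring
    refine ⟨a3, (b3.const_mul r).congr eF, ?_⟩
    rw [integral_congr_ae eu, integral_congr_ae eg, integral_const_mul, integral_const_mul] at a4
    rw [← integral_congr_ae eF, integral_const_mul]
    linear_combination (-1 : ℝ) * a4 + r * b4
  refine ⟨⟨⟨T, hadd⟩, hsmul⟩, ⟨h1, h2, h3, h4⟩, fun c' Tr' _ hTr' => ?_⟩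
  refine LinearMap.ext fun u => ?_
  -- Uniqueness uses only the integration by parts formula in the vertical direction.
  refine bdry_eq_of_integral_eq hab hp fun ψ hψ hψc => ?_
  obtain ⟨a1, a2, a3, a4⟩ := hTr'.integration_by_parts u ψ hψ hψc (Fin.last d)
  obtain ⟨b1, b2, b3, b4⟩ := h4 u ψ hψ hψc (Fin.last d)
  exact ⟨a3, b3, add_left_cancel (a4.symm.trans b4)⟩
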